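/- Let $G$ be a finite simple graph with vertex set $V_G=\{x_1,\dots,x_n\}$ and edge set $E_G$, let $k$ be a field, and let $R=k[x_1,\dots,x_n]$ be the polynomial ring with its standard grading. Let $$I(G)=\langle\, x_ax_b \;:\; \{x_a,x_b\}\in E_G\,\rangle\subseteq R$$ be the edge ideal of $G$. For a homogeneous ideal $I\subseteq R$ let $\beta_{i,j}(I)=\dim_k \operatorname{Tor}_i^R(I,k)_j$ denote its graded Betti numbers, where $k=R/(x_1,\dots,x_n)$. If $G$ is a forest (that is, $G$ has no cycles), then $$\beta_{0,2}(I(G))=\#E_G$$ and $$\beta_{i,i+2}(I(G))=\sum_{v\in V_G}\binom{\deg v}{i+1}\qquad\text{for all } i\ge 1,$$ where $\deg v$ is the number of edges incident to $v$. -/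

import Mathlib

open MvPolynomial

noncomputable section

namespace GradedBetti

universe u v w

attribute [local instance] MvPolynomial.gradedAlgebra

variable {V : Type u} {k : Type v} [Field k]

/-- Let `F` be the free module over `R = k[x_v : v ∈ V]` with basis `e_b`, `b ∈ ι`, where `e_b` is
placed in degree `deg b`; that is, `F = ⨁_b R(-deg b)`.  `IsHomogeneousVec deg n f` says that
`f ∈ F` is homogeneous of degree `n`: every monomial `x^m e_b` that occurs in `f` satisfies
`|m| + deg b = n`. -/
def IsHomogeneousVec {ι : Type w} (deg : ι → ℕ) (n : ℕ) (f : ι →₀ MvPolynomial V k) : Prop :=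
  ∀ (b : ι) (m : V →₀ ℕ), coeff m (f b) ≠ 0 → m.degree + deg b = n

/-- A graded free resolution (not necessarily minimal)
`⋯ ⟶ F₂ ⟶ F₁ ⟶ F₀ ⟶ I ⟶ 0` of an ideal `I` of the standard graded polynomial ring
`R = k[x_v : v ∈ V]`: an exact sequence of graded free modules `F_i = ⨁_{b ∈ ι i} R(-deg i b)`
in which all maps are `R`-linear and homogeneous of degree `0`. -/
structure GradedFreeResolution (I : Ideal (MvPolynomial V k)) where
  /-- the index set of a homogeneous basis of `F_i` -/
  ι : ℕ → Type (max u v)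
  /-- the degrees of the basis elements -/
  deg : ∀ i, ι i → ℕ
  /-- the augmentation `F₀ → I ⊆ R` -/
  aug : (ι 0 →₀ MvPolynomial V k) →ₗ[MvPolynomial V k] MvPolynomial V k
  /-- the differential `F_{i+1} → F_i` -/
  d : ∀ i, (ι (i + 1) →₀ MvPolynomial V k) →ₗ[MvPolynomial V k] (ι i →₀ MvPolynomial V k)
  aug_homogeneous : ∀ b, (aug (Finsupp.single b 1)).IsHomogeneous (deg 0 b)
  d_homogeneous : ∀ i b, IsHomogeneousVec (deg i) (deg (i + 1) b) (d i (Finsupp.single b 1))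
  range_aug : LinearMap.range aug = I
  exact_zero : Function.Exact (d 0) aug
  exact_succ : ∀ i, Function.Exact (d (i + 1)) (d i)

namespace GradedFreeResolution

variable {I : Ideal (MvPolynomial V k)} (F : GradedFreeResolution I)

/-- The differential `F_{i+1} ⊗_R k → F_i ⊗_R k`, where `k = R / (x_v : v ∈ V)`.  The space
`F_i ⊗_R k` is the `k`-vector space with basis `ι i`, and the matrix of the differential is
obtained from that of `d i` by taking constant coefficients. -/
def dTensor (i : ℕ) : (F.ι (i + 1) →₀ k) →ₗ[k] (F.ι i →₀ k) :=
  Finsupp.linearCombination k fun b =>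
    (F.d i (Finsupp.single b 1)).mapRange (constantCoeff (σ := V) (R := k)) (map_zero _)

/-- The homogeneous component `(F_i ⊗_R k)_j`, spanned by the basis elements of degree `j`. -/
def tensorPiece (i j : ℕ) : Submodule k (F.ι i →₀ k) :=
  Finsupp.supported k k {b | F.deg i b = j}

/-- The `i`-cycles of degree `j` of the complex `F ⊗_R k`. -/
def cycles : ∀ i _j : ℕ, Submodule k (F.ι i →₀ k)
  | 0, j => F.tensorPiece 0 j
  | i + 1, j => F.tensorPiece (i + 1) j ⊓ LinearMap.ker (F.dTensor i)

/-- The `i`-boundaries of degree `j` of the complex `F ⊗_R k`. -/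
def boundaries (i j : ℕ) : Submodule k (F.ι i →₀ k) :=
  (F.tensorPiece (i + 1) j).map (F.dTensor i)

/-- Cycles of degree `j` modulo boundaries of degree `j`: this is `Tor_i^R(I, k)_j`, the degree `j`
part of the `i`-th homology of `F ⊗_R k`, as a subspace of `(F_i ⊗_R k) / boundaries`. -/
def tor (i j : ℕ) : Submodule k ((F.ι i →₀ k) ⧸ F.boundaries i j) :=
  (F.cycles i j).map (F.boundaries i j).mkQ

end GradedFreeResolution

/-! ### Every homogeneous ideal has a graded free resolution -/

/-- The component of degree `n` of an element of `⨁_b R(-deg b)`. -/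
def vecComponent {ι : Type w} (deg : ι → ℕ) (n : ℕ) (f : ι →₀ MvPolynomial V k) :
    ι →₀ MvPolynomial V k :=
  Finsupp.onFinset f.support
    (fun b => if deg b ≤ n then homogeneousComponent (n - deg b) (f b) else 0)
    (by
      intro b hb
      by_contra h
      rw [Finsupp.notMem_support_iff] at h
      simp [h] at hb)

theorem coeff_vecComponent {ι : Type w} (deg : ι → ℕ) (n : ℕ) (f : ι →₀ MvPolynomial V k)
    (b : ι) (m : V →₀ ℕ) :
    coeff m (vecComponent deg n f b) = if m.degree + deg b = n then coeff m (f b) else 0 := by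
  simp only [vecComponent, Finsupp.onFinset_apply]
  split_ifs with h1 h2 h2
  · rw [coeff_homogeneousComponent, if_pos (by omega)]
  · rw [coeff_homogeneousComponent, if_neg (by omega)]
  · omega
  · simp

theorem vec_ext {ι : Type w} {f g : ι →₀ MvPolynomial V k}
    (h : ∀ b m, coeff m (f b) = coeff m (g b)) : f = g :=
  Finsupp.ext fun b => MvPolynomial.ext _ _ (h b)

theorem vecComponent_homogeneous {ι : Type w} (deg : ι → ℕ) (n : ℕ)
    (f : ι →₀ MvPolynomial V k) : IsHomogeneousVec deg n (vecComponent deg n f) := by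
  intro b m h
  rw [coeff_vecComponent] at h
  by_contra h'
  simp [h'] at h

theorem vecComponent_add {ι : Type w} (deg : ι → ℕ) (n : ℕ) (f g : ι →₀ MvPolynomial V k) :
    vecComponent deg n (f + g) = vecComponent deg n f + vecComponent deg n g := by
  refine vec_ext fun b m => ?_
  simp only [Finsupp.add_apply, coeff_add, coeff_vecComponent]
  split_ifs <;> simp

theorem vecComponent_of_homogeneous {ι : Type w} {deg : ι → ℕ} {n : ℕ}
    {f : ι →₀ MvPolynomial V k} (hf : IsHomogeneousVec deg n f) (m : ℕ) :
    vecComponent deg m f = if m = n then f else 0 := by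
  refine vec_ext fun b a => ?_
  rw [coeff_vecComponent]
  by_cases h0 : coeff a (f b) = 0
  · split_ifs <;> simp [h0]
  · have := hf b a h0
    by_cases hm : m = n
    · rw [if_pos (by omega), if_pos hm]
    · rw [if_neg (by omega), if_neg hm]
      simp

theorem exists_sum_vecComponent {ι : Type w} (deg : ι → ℕ) (f : ι →₀ MvPolynomial V k) :
    ∃ s : Finset ℕ, ∑ n ∈ s, vecComponent deg n f = f := by
  classical
  refine ⟨f.support.biUnion fun b => (f b).support.image fun m => m.degree + deg b,
    vec_ext fun b m => ?_⟩
  rw [Finsupp.finsetSum_apply, coeff_sum]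
  simp only [coeff_vecComponent]
  rw [Finset.sum_ite_eq]
  split_ifs with h
  · rfl
  · by_contra hne
    refine h (Finset.mem_biUnion.2 ⟨b, ?_, Finset.mem_image.2 ⟨m, ?_, rfl⟩⟩)
    · rw [Finsupp.mem_support_iff]
      intro h0
      simp [h0] at hne
    · rw [MvPolynomial.mem_support_iff]
      exact fun h0 => hne h0.symm

theorem IsHomogeneousVec.monomial_smul {ι : Type w} {deg : ι → ℕ} {n : ℕ}
    {f : ι →₀ MvPolynomial V k} (hf : IsHomogeneousVec deg n f) (u : V →₀ ℕ) (a : k) :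
    IsHomogeneousVec deg (u.degree + n) (monomial u a • f) := by
  classical
  intro b m h
  rw [Finsupp.smul_apply, smul_eq_mul, coeff_monomial_mul'] at h
  split_ifs at h with hle
  · have h1 := hf b (m - u) (right_ne_zero_of_mul h)
    have h2 : u.degree + (m - u).degree = m.degree := by
      rw [← map_add, add_tsub_cancel_of_le hle]
    omega
  · exact absurd rfl h

/-- A map of graded free modules that sends basis vectors to homogeneous vectors of the right
degree commutes with taking components. -/
theorem map_vecComponent {ι κ : Type w} (deg : ι → ℕ) (deg' : κ → ℕ)
    (φ : (ι →₀ MvPolynomial V k) →ₗ[MvPolynomial V k] (κ →₀ MvPolynomial V k))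
    (hφ : ∀ b, IsHomogeneousVec deg' (deg b) (φ (Finsupp.single b 1))) (n : ℕ)
    (f : ι →₀ MvPolynomial V k) :
    φ (vecComponent deg n f) = vecComponent deg' n (φ f) := by
  classical
  have hz : ∀ {α : Type w} (e : α → ℕ), vecComponent e n (0 : α →₀ MvPolynomial V k) = 0 := by
    intro α e
    exact vec_ext fun b m => by rw [coeff_vecComponent]; simp
  induction f using Finsupp.induction_linear with
  | zero => rw [map_zero, hz, hz, map_zero]
  | add f g hf hg => rw [vecComponent_add, map_add, hf, hg, map_add, vecComponent_add]
  | single b p =>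
    induction p using MvPolynomial.induction_on' with
    | monomial m a =>
      have h1 : IsHomogeneousVec deg (deg b) (Finsupp.single b (1 : MvPolynomial V k)) := by
        intro c l h
        rw [Finsupp.single_apply] at h
        split_ifs at h with hbc
        · subst hbc
          rw [coeff_one] at h
          split_ifs at h with hl
          · subst hl
            simp
          · exact absurd rfl h
        · simp at h
      have h2 : (Finsupp.single b (monomial m a) : ι →₀ MvPolynomial V k) =
          monomial m a • Finsupp.single b 1 := by
        rw [Finsupp.smul_single, smul_eq_mul, mul_one]
      rw [h2, map_smul, vecComponent_of_homogeneous (h1.monomial_smul m a),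
        vecComponent_of_homogeneous ((hφ b).monomial_smul m a)]
      split_ifs
      · rw [map_smul]
      · rw [map_zero]
    | add p q hp hq =>
      rw [Finsupp.single_add, vecComponent_add, map_add, hp, hq, map_add, vecComponent_add]

/-- A graded submodule of a graded free module over `k[x_v : v ∈ V]`. -/
structure GradedSub (V : Type u) (k : Type v) [Field k] where
  ι : Type (max u v)
  deg : ι → ℕ
  Z : Submodule (MvPolynomial V k) (ι →₀ MvPolynomial V k)
  graded : ∀ n, ∀ f ∈ Z, vecComponent deg n f ∈ Z

namespace GradedSub

variable (S : GradedSub V k)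

/-- All homogeneous elements of a graded submodule. -/
def Gen : Type (max u v) :=
  {p : ℕ × (S.ι →₀ MvPolynomial V k) // p.2 ∈ S.Z ∧ IsHomogeneousVec S.deg p.1 p.2}

/-- The graded free module on all homogeneous elements of `Z` maps onto `Z`. -/
def genMap : (S.Gen →₀ MvPolynomial V k) →ₗ[MvPolynomial V k] (S.ι →₀ MvPolynomial V k) :=
  Finsupp.linearCombination _ fun p => p.1.2

theorem genMap_single (p : S.Gen) : S.genMap (Finsupp.single p 1) = p.1.2 := by
  simp [genMap]

theorem range_genMap : LinearMap.range S.genMap = S.Z := by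
  apply le_antisymm
  · rw [genMap, Finsupp.range_linearCombination, Submodule.span_le]
    rintro _ ⟨p, rfl⟩
    exact p.2.1
  · intro f hf
    obtain ⟨s, hs⟩ := exists_sum_vecComponent S.deg f
    rw [← hs]
    refine Submodule.sum_mem _ fun n _ => ?_
    exact ⟨_, S.genMap_single
      ⟨(n, vecComponent S.deg n f), S.graded n f hf, vecComponent_homogeneous S.deg n f⟩⟩

/-- The kernel of `genMap`, the next syzygy module. -/
def next : GradedSub V k where
  ι := S.Gen
  deg p := p.1.1
  Z := LinearMap.ker S.genMap
  graded n f hf := by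
    have h0 : vecComponent S.deg n (0 : S.ι →₀ MvPolynomial V k) = 0 :=
      vec_ext fun b m => by rw [coeff_vecComponent]; simp
    rw [LinearMap.mem_ker] at hf ⊢
    rw [map_vecComponent (fun p : S.Gen => p.1.1) S.deg S.genMap ?_ n f, hf, h0]
    intro p
    rw [genMap_single]
    exact p.2.2

/-- The map of free modules from the generators of the syzygy module to the generators of `Z`. -/
def stepMap : (S.next.Gen →₀ MvPolynomial V k) →ₗ[MvPolynomial V k] (S.Gen →₀ MvPolynomial V k) :=
  S.next.genMap

theorem stepMap_homogeneous (p : S.next.Gen) :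
    IsHomogeneousVec (fun q : S.Gen => q.1.1) p.1.1 (S.stepMap (Finsupp.single p 1)) := by
  have h : S.stepMap (Finsupp.single p 1) = p.1.2 := S.next.genMap_single p
  rw [h]
  exact p.2.2

theorem exact_stepMap_genMap : Function.Exact S.stepMap S.genMap := by
  have h : LinearMap.range S.stepMap = LinearMap.ker S.genMap := S.next.range_genMap
  exact LinearMap.exact_iff.2 h.symm

/-- The iterated syzygy modules. -/
def iter : ℕ → GradedSub V k
  | 0 => S
  | n + 1 => (iter n).next

/-- A homogeneous ideal as a graded submodule of the free module `R`. -/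
def ofIdeal (I : HomogeneousIdeal (homogeneousSubmodule V k)) : GradedSub V k where
  ι := PUnit
  deg _ := 0
  Z := Submodule.comap
    (Finsupp.lapply PUnit.unit : (PUnit →₀ MvPolynomial V k) →ₗ[MvPolynomial V k] _) I.toIdeal
  graded n f hf := by
    rw [Submodule.mem_comap, Finsupp.lapply_apply] at hf ⊢
    have h : vecComponent (fun _ : PUnit => 0) n f PUnit.unit =
        homogeneousComponent n (f PUnit.unit) := by
      refine MvPolynomial.ext _ _ fun m => ?_
      rw [coeff_vecComponent, coeff_homogeneousComponent]
      simp
    rw [h]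
    exact homogeneousComponent_mem_of_mem I.isHomogeneous hf n

/-- The inclusion of `Z` into `R`, in the case of an ideal. -/
def coord (I : HomogeneousIdeal (homogeneousSubmodule V k)) :
    ((ofIdeal I).ι →₀ MvPolynomial V k) →ₗ[MvPolynomial V k] MvPolynomial V k :=
  Finsupp.lapply PUnit.unit

theorem coord_injective (I : HomogeneousIdeal (homogeneousSubmodule V k)) :
    Function.Injective (coord I) :=
  fun _ _ h => Finsupp.ext fun _ => h

/-- The free cover of a homogeneous ideal by all of its homogeneous elements. -/
def augMap (I : HomogeneousIdeal (homogeneousSubmodule V k)) :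
    ((ofIdeal I).Gen →₀ MvPolynomial V k) →ₗ[MvPolynomial V k] MvPolynomial V k :=
  (coord I).comp (ofIdeal I).genMap

theorem augMap_homogeneous (I : HomogeneousIdeal (homogeneousSubmodule V k)) (p : (ofIdeal I).Gen) :
    (augMap I (Finsupp.single p 1)).IsHomogeneous p.1.1 := by
  have h : augMap I (Finsupp.single p 1) = coord I p.1.2 :=
    congrArg (coord I) ((ofIdeal I).genMap_single p)
  rw [h]
  intro m hm
  have h2 : m.degree + 0 = p.1.1 := p.2.2 PUnit.unit m hm
  rw [Finsupp.degree_eq_weight_one] at h2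
  exact h2

theorem range_augMap (I : HomogeneousIdeal (homogeneousSubmodule V k)) :
    LinearMap.range (augMap I) = I.toIdeal := by
  have hs : Function.Surjective (coord I) := fun r =>
    ⟨Finsupp.single (PUnit.unit : PUnit) r, Finsupp.single_eq_same⟩
  rw [augMap, LinearMap.range_comp, range_genMap]
  exact Submodule.map_comap_eq_of_surjective hs I.toIdeal

theorem exact_augMap (I : HomogeneousIdeal (homogeneousSubmodule V k)) :
    Function.Exact (ofIdeal I).stepMap (augMap I) := by
  intro y
  rw [← (ofIdeal I).exact_stepMap_genMap y]
  exact ⟨fun h' => coord_injective I (h'.trans (map_zero _).symm),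
    fun h' => (congrArg (coord I) h').trans (map_zero _)⟩

end GradedSub

theorem nonempty_gradedFreeResolution (I : HomogeneousIdeal (homogeneousSubmodule V k)) :
    Nonempty (GradedFreeResolution I.toIdeal) :=
  ⟨{  ι := fun i => ((GradedSub.ofIdeal I).iter i).Gen
      deg := fun _ p => p.1.1
      aug := GradedSub.augMap I
      d := fun i => ((GradedSub.ofIdeal I).iter i).stepMap
      aug_homogeneous := GradedSub.augMap_homogeneous I
      d_homogeneous := fun i => ((GradedSub.ofIdeal I).iter i).stepMap_homogeneous
      range_aug := GradedSub.range_augMap I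
      exact_zero := GradedSub.exact_augMap I
      exact_succ := fun i => ((GradedSub.ofIdeal I).iter (i + 1)).exact_stepMap_genMap }⟩

/-- A graded free resolution of a homogeneous ideal; up to graded isomorphism, the spaces
`Tor_i^R(I, k)_j` computed from it do not depend on which one is taken. -/
def resolution (I : HomogeneousIdeal (homogeneousSubmodule V k)) :
    GradedFreeResolution I.toIdeal :=
  Classical.choice (nonempty_gradedFreeResolution I)

/-- The graded Betti number `β_{i,j}(I) = dim_k Tor_i^R(I, k)_j`, as a cardinal number. -/
def gradedBetti (I : HomogeneousIdeal (homogeneousSubmodule V k)) (i j : ℕ) :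
    Cardinal.{max u v} :=
  Module.rank k ((resolution I).tor i j)

/-- The edge ideal `I(G) = ⟨x_a x_b : {a, b} is an edge of G⟩` of `k[x_v : v ∈ V]`. -/
def edgeIdeal (k : Type v) [Field k] (G : SimpleGraph V) :
    HomogeneousIdeal (homogeneousSubmodule V k) where
  toSubmodule := Ideal.span {p | ∃ a b : V, G.Adj a b ∧ p = X a * X b}
  is_homogeneous' := Ideal.homogeneous_span _ _ (by
    rintro _ ⟨a, b, -, rfl⟩
    exact ⟨2, (isHomogeneous_X k a).mul (isHomogeneous_X k b)⟩)

end GradedBetti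

end

open MvPolynomial

noncomputable section

namespace GradedBetti

universe u v w

attribute [local instance] MvPolynomial.gradedAlgebra

/-! `Tor` is balanced: instead of resolving `I = I(G)`, one may tensor `I` with the Koszul complex
on the variables. `rank_tor_eq_rank_koszulHomology` thus identifies `Tor_i` in degree `n + i + 1`
with the homology at `Λ^i ⊗ I_{n+1}`. It is proved by dimension shifting along the syzygies, using
that the Koszul complex of a free module is acyclic (`exists_koszulD_eq`). For `n = 1` the
boundaries come from `I_1 = 0`, so the Betti number is the dimension of the space of cycles in `Λ^i
⊗ I_2`, where `I_2` has the edge monomials as a basis.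

For `i = 0` everything is a cycle, and edges are counted. For `i ≥ 1`, a vertex `v` and a set `L` of
`i + 1` neighbours give the cycle `x_v ∂(e_L)`, with terms `± x_v x_t e_{L \ t}`; these cycles form
a basis. The coordinate at `(v, L)` is the coefficient of `x_v x_t e_{L \ t}` for `t = min L`. Since
there are no triangles, the coordinates are dual to the star cycles (`coeff_starCycle_of_ne`).
Conversely, cancellation in `∂f = 0` propagates nonzero coefficients (`IsEdgeChain.exchange`), and
without triangles and 4-cycles a nonzero coefficient forces a whole star of nonzero ones
(`IsEdgeChain.exists_star`); hence a cycle with zero coordinates vanishes. -/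

/-- A correspondence `A ← Y → B` that is onto cycles on both sides and matches boundaries induces
an isomorphism of homology. -/
theorem rank_map_mkQ_eq {k : Type v} [Field k] {A B Y : Type w} [AddCommGroup A] [AddCommGroup B]
    [AddCommGroup Y] [Module k A] [Module k B] [Module k Y]
    {A₀ A₁ : Submodule k A} {B₀ B₁ : Submodule k B} (Y₀ : Submodule k Y)
    (p : Y →ₗ[k] A) (r : Y →ₗ[k] B)
    (hp : ∀ y ∈ Y₀, p y ∈ A₀) (hr : ∀ y ∈ Y₀, r y ∈ B₀)
    (hp' : ∀ a ∈ A₀, ∃ y ∈ Y₀, p y = a) (hr' : ∀ b ∈ B₀, ∃ y ∈ Y₀, r y = b)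
    (h : ∀ y ∈ Y₀, p y ∈ A₁ ↔ r y ∈ B₁) :
    Module.rank k (A₀.map A₁.mkQ) = Module.rank k (B₀.map B₁.mkQ) := by
  have hA : Y₀.map p = A₀ := by
    ext a
    exact ⟨fun ⟨y, hy, e⟩ => e ▸ hp y hy, fun ha => hp' a ha⟩
  have hB : Y₀.map r = B₀ := by
    ext a
    exact ⟨fun ⟨y, hy, e⟩ => e ▸ hr y hy, fun ha => hr' a ha⟩
  let f : Y₀ →ₗ[k] A ⧸ A₁ := A₁.mkQ ∘ₗ p ∘ₗ Y₀.subtype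
  let g : Y₀ →ₗ[k] B ⧸ B₁ := B₁.mkQ ∘ₗ r ∘ₗ Y₀.subtype
  have hf : LinearMap.range f = A₀.map A₁.mkQ := by
    rw [LinearMap.range_comp, LinearMap.range_comp, Submodule.range_subtype, hA]
  have hg : LinearMap.range g = B₀.map B₁.mkQ := by
    rw [LinearMap.range_comp, LinearMap.range_comp, Submodule.range_subtype, hB]
  -- Both homology spaces are the quotient of `Y₀` by this common kernel.
  have hk : LinearMap.ker f = LinearMap.ker g := by
    ext ⟨y, hy⟩
    simpa [f, g] using h y hy
  rw [← hf, ← hg, ← f.quotKerEquivRange.rank_eq, ← g.quotKerEquivRange.rank_eq, hk]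

variable {V : Type u} {k : Type v} [Field k]

/-! ### Homogeneous pieces of free modules and of images -/

section Pieces

variable {ι κ μ : Type w}

/-- The homogeneous component of degree `n` of the graded free module `⨁_b R(-deg b)`. -/
def homPiece (k : Type v) [Field k] (V : Type u) (deg : ι → ℕ) (n : ℕ) :
    Submodule k (ι →₀ MvPolynomial V k) where
  carrier := {f | IsHomogeneousVec deg n f}
  zero_mem' := fun b m h => absurd (by simp) h
  add_mem' := by
    intro f g hf hg b m h
    by_contra hne
    refine h ?_
    rw [Finsupp.add_apply, coeff_add, of_not_not fun h0 => hne (hf b m h0),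
      of_not_not fun h0 => hne (hg b m h0), add_zero]
  smul_mem' := by
    intro c f hf b m h
    refine hf b m fun h0 => h ?_
    rw [Finsupp.smul_apply, coeff_smul, h0, smul_zero]

theorem mem_homPiece {deg : ι → ℕ} {n : ℕ} {f : ι →₀ MvPolynomial V k} :
    f ∈ homPiece k V deg n ↔
      ∀ (b : ι) (m : V →₀ ℕ), coeff m (f b) ≠ 0 → m.degree + deg b = n := Iff.rfl

/-- The homogeneous component of degree `n` of the image of a graded map. -/
def imPiece (deg : ι → ℕ)
    (φ : (ι →₀ MvPolynomial V k) →ₗ[MvPolynomial V k] (κ →₀ MvPolynomial V k)) (n : ℕ) :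
    Submodule k (κ →₀ MvPolynomial V k) :=
  (homPiece k V deg n).map (φ.restrictScalars k)

/-- A linear map of graded free modules is homogeneous of degree zero. -/
def IsGradedMap (deg : ι → ℕ) (deg' : κ → ℕ)
    (φ : (ι →₀ MvPolynomial V k) →ₗ[MvPolynomial V k] (κ →₀ MvPolynomial V k)) : Prop :=
  ∀ b, IsHomogeneousVec deg' (deg b) (φ (Finsupp.single b 1))

theorem vecComponent_eq_self {deg : ι → ℕ} {n : ℕ} {f : ι →₀ MvPolynomial V k}
    (hf : f ∈ homPiece k V deg n) : vecComponent deg n f = f := by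
  rw [vecComponent_of_homogeneous hf, if_pos rfl]

theorem IsGradedMap.map_mem {deg : ι → ℕ} {deg' : κ → ℕ}
    {φ : (ι →₀ MvPolynomial V k) →ₗ[MvPolynomial V k] (κ →₀ MvPolynomial V k)}
    (hφ : IsGradedMap deg deg' φ) {n : ℕ} {f : ι →₀ MvPolynomial V k}
    (hf : f ∈ homPiece k V deg n) : φ f ∈ homPiece k V deg' n := by
  have h := map_vecComponent deg deg' φ hφ n f
  rw [vecComponent_eq_self hf] at h
  rw [h]
  exact vecComponent_homogeneous deg' n _

/-- The degree `n` component of any preimage is again a preimage. -/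
theorem IsGradedMap.exists_preimage {deg : ι → ℕ} {deg' : κ → ℕ}
    {φ : (ι →₀ MvPolynomial V k) →ₗ[MvPolynomial V k] (κ →₀ MvPolynomial V k)}
    (hφ : IsGradedMap deg deg' φ) {n : ℕ} {g : κ →₀ MvPolynomial V k}
    (hg : g ∈ homPiece k V deg' n) (h : g ∈ LinearMap.range φ) :
    ∃ f ∈ homPiece k V deg n, φ f = g := by
  obtain ⟨f, rfl⟩ := h
  refine ⟨vecComponent deg n f, vecComponent_homogeneous deg n f, ?_⟩
  rw [map_vecComponent deg deg' φ hφ n f, vecComponent_eq_self hg]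

theorem mem_imPiece_iff {deg : ι → ℕ} {deg' : κ → ℕ}
    {ψ : (ι →₀ MvPolynomial V k) →ₗ[MvPolynomial V k] (κ →₀ MvPolynomial V k)}
    {φ : (κ →₀ MvPolynomial V k) →ₗ[MvPolynomial V k] (μ →₀ MvPolynomial V k)}
    (hψ : IsGradedMap deg deg' ψ) (h : Function.Exact ψ φ) {n : ℕ}
    {g : κ →₀ MvPolynomial V k} :
    g ∈ imPiece deg ψ n ↔ g ∈ homPiece k V deg' n ∧ φ g = 0 := by
  constructor
  · rintro ⟨f, hf, rfl⟩
    exact ⟨hψ.map_mem hf, (h _).2 ⟨f, rfl⟩⟩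
  · rintro ⟨hg, h0⟩
    obtain ⟨f, hf, e⟩ := hψ.exists_preimage hg ((h g).1 h0)
    exact ⟨f, hf, e⟩

end Pieces

/-! ### Exterior powers with coefficients in a graded piece -/

section KoszulPieces

variable {ι κ μ : Type w}

/-- The map on `Λ(V) ⊗ F` induced by a map of free modules. -/
def koszulMap (φ : (ι →₀ MvPolynomial V k) →ₗ[MvPolynomial V k] (κ →₀ MvPolynomial V k)) :
    (Finset V → ι →₀ MvPolynomial V k) →ₗ[k] (Finset V → κ →₀ MvPolynomial V k) :=
  (φ.restrictScalars k).compLeft (Finset V)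

theorem koszulMap_apply
    (φ : (ι →₀ MvPolynomial V k) →ₗ[MvPolynomial V k] (κ →₀ MvPolynomial V k))
    (f : Finset V → ι →₀ MvPolynomial V k) (S : Finset V) : koszulMap φ f S = φ (f S) := rfl

/-- `Λ^q(V) ⊗ W` for a subspace `W` of a free module. -/
def koszulPiece (W : Submodule k (ι →₀ MvPolynomial V k)) (q : ℕ) :
    Submodule k (Finset V → ι →₀ MvPolynomial V k) :=
  Submodule.pi Set.univ fun S => if S.card = q then W else ⊥

theorem mem_koszulPiece {W : Submodule k (ι →₀ MvPolynomial V k)} {q : ℕ}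
    {f : Finset V → ι →₀ MvPolynomial V k} :
    f ∈ koszulPiece W q ↔ (∀ S, f S ∈ W) ∧ ∀ S, S.card ≠ q → f S = 0 := by
  simp only [koszulPiece, Submodule.mem_pi, Set.mem_univ, true_imp_iff]
  refine ⟨fun h => ⟨fun S => ?_, fun S hS => ?_⟩, fun h S => ?_⟩
  · have := h S
    split_ifs at this
    · exact this
    · rw [(Submodule.mem_bot k).1 this]
      exact W.zero_mem
  · simpa [hS] using h S
  · split_ifs with hS
    · exact h.1 S
    · exact (Submodule.mem_bot k).2 (h.2 S hS)

theorem X_smul_mem_homPiece {deg : ι → ℕ} {n : ℕ} (v : V) {g : ι →₀ MvPolynomial V k}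
    (hg : g ∈ homPiece k V deg n) : (X v : MvPolynomial V k) • g ∈ homPiece k V deg (n + 1) := by
  have h := IsHomogeneousVec.monomial_smul hg (Finsupp.single v 1) 1
  rw [Finsupp.degree_single, add_comm] at h
  exact h

theorem koszulMap_mem {deg : ι → ℕ} {n q : ℕ}
    (φ : (ι →₀ MvPolynomial V k) →ₗ[MvPolynomial V k] (κ →₀ MvPolynomial V k))
    {f : Finset V → ι →₀ MvPolynomial V k} (hf : f ∈ koszulPiece (homPiece k V deg n) q) :
    koszulMap φ f ∈ koszulPiece (imPiece deg φ n) q := by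
  rw [mem_koszulPiece] at hf ⊢
  refine ⟨fun S => ⟨f S, hf.1 S, rfl⟩, fun S hS => ?_⟩
  rw [koszulMap_apply, hf.2 S hS, map_zero]

theorem exists_koszulMap_eq {deg : ι → ℕ} {n q : ℕ}
    {φ : (ι →₀ MvPolynomial V k) →ₗ[MvPolynomial V k] (κ →₀ MvPolynomial V k)}
    {g : Finset V → κ →₀ MvPolynomial V k} (hg : g ∈ koszulPiece (imPiece deg φ n) q) :
    ∃ f ∈ koszulPiece (homPiece k V deg n) q, koszulMap φ f = g := by
  rw [mem_koszulPiece] at hg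
  choose f hf e using hg.1
  refine ⟨fun S => if S.card = q then f S else 0, mem_koszulPiece.2 ⟨fun S => ?_, fun S hS => ?_⟩,
    funext fun S => ?_⟩
  · split_ifs
    exacts [hf S, Submodule.zero_mem _]
  · exact if_neg hS
  · rw [koszulMap_apply]
    split_ifs with hS
    · exact e S
    · rw [map_zero, hg.2 S hS]

/-- Exactness read coefficientwise; this is how chains with coefficients in a syzygy module are
recognised. -/
theorem koszulPiece_imPiece_iff {deg : ι → ℕ} {deg' : κ → ℕ}
    {ψ : (ι →₀ MvPolynomial V k) →ₗ[MvPolynomial V k] (κ →₀ MvPolynomial V k)}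
    {φ : (κ →₀ MvPolynomial V k) →ₗ[MvPolynomial V k] (μ →₀ MvPolynomial V k)}
    (hψ : IsGradedMap deg deg' ψ) (h : Function.Exact ψ φ) {n q : ℕ}
    {g : Finset V → κ →₀ MvPolynomial V k} :
    g ∈ koszulPiece (imPiece deg ψ n) q ↔
      g ∈ koszulPiece (homPiece k V deg' n) q ∧ koszulMap φ g = 0 := by
  simp only [mem_koszulPiece, mem_imPiece_iff hψ h, funext_iff, koszulMap_apply, Pi.zero_apply,
    forall_and]
  tauto

end KoszulPieces

/-! ### The Koszul differential -/

section Koszul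

variable [LinearOrder V]

/-- The sign of `e_v ∧ e_S`, where `e_S` is the wedge product in increasing order. -/
def koszulSign (v : V) (S : Finset V) : ℤ := (-1) ^ (S.filter (· < v)).card

theorem koszulSign_insert {v u : V} {S : Finset V} (hu : u ∉ S) :
    koszulSign v (insert u S) = if u < v then -koszulSign v S else koszulSign v S := by
  unfold koszulSign
  rw [Finset.filter_insert]
  split_ifs with h
  · rw [Finset.card_insert_of_notMem (by simp [hu]), pow_succ]
    ring
  · rfl

theorem koszulSign_eq_one {v : V} {S : Finset V} (h : ∀ u ∈ S, v ≤ u) : koszulSign v S = 1 := by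
  unfold koszulSign
  rw [Finset.filter_eq_empty_iff.2 fun u hu => not_lt.2 (h u hu)]
  simp

theorem koszulSign_ne_zero (v : V) (S : Finset V) : (koszulSign v S : k) ≠ 0 := by
  simp [koszulSign]

/-- Inserting an element flips only the signs of larger ones, so exactly one of the two products
changes sign. -/
theorem koszulSign_swap {v u : V} {S : Finset V} (hu : u ∉ S) (hv : v ∉ S) (h : u ≠ v) :
    koszulSign v S * koszulSign u (insert v S) + koszulSign u S * koszulSign v (insert u S) = 0 := by
  rw [koszulSign_insert hu, koszulSign_insert hv]
  rcases lt_or_gt_of_ne h with h | h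
  · rw [if_neg h.not_gt, if_pos h]; ring
  · rw [if_pos h, if_neg h.not_gt]; ring

variable [Fintype V] {ι κ : Type w}

/-- The Koszul differential on `Λ(V) ⊗ F`; an element is written as a family of coefficients
indexed by the subsets of `V`. -/
def koszulD (k : Type v) [Field k] (V : Type u) [LinearOrder V] [Fintype V] (ι : Type w) :
    (Finset V → ι →₀ MvPolynomial V k) →ₗ[k] (Finset V → ι →₀ MvPolynomial V k) where
  toFun f S := ∑ v ∈ Sᶜ, koszulSign v S • (X v : MvPolynomial V k) • f (insert v S)
  map_add' f g := by
    funext S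
    simp only [Pi.add_apply, smul_add, Finset.sum_add_distrib]
  map_smul' c f := by
    funext S
    simp only [Pi.smul_apply, RingHom.id_apply, Finset.smul_sum]
    refine Finset.sum_congr rfl fun v _ => ?_
    rw [smul_comm (X v : MvPolynomial V k) c, smul_comm (koszulSign v S) c]

theorem koszulD_apply (f : Finset V → ι →₀ MvPolynomial V k) (S : Finset V) :
    koszulD k V ι f S =
      ∑ v ∈ Sᶜ, koszulSign v S • (X v : MvPolynomial V k) • f (insert v S) := rfl

theorem coeff_koszulD (f : Finset V → ι →₀ MvPolynomial V k) (S : Finset V) (b : ι)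
    (a : V →₀ ℕ) :
    coeff a (koszulD k V ι f S b) = ∑ v ∈ Sᶜ, (koszulSign v S : k) *
      if v ∈ a.support then coeff (a - Finsupp.single v 1) (f (insert v S) b) else 0 := by
  rw [koszulD_apply, Finsupp.finsetSum_apply, coeff_sum]
  refine Finset.sum_congr rfl fun v _ => ?_
  rw [← Int.cast_smul_eq_zsmul k, Finsupp.smul_apply, coeff_smul, Finsupp.smul_apply, smul_eq_mul,
    smul_eq_mul, coeff_X_mul']

/-- The terms that remove `v, u` and `u, v` cancel in pairs by `koszulSign_swap`. -/
theorem koszulD_koszulD (f : Finset V → ι →₀ MvPolynomial V k) :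
    koszulD k V ι (koszulD k V ι f) = 0 := by
  funext S
  rw [koszulD_apply, Pi.zero_apply]
  simp only [koszulD_apply, Finset.smul_sum]
  rw [Finset.sum_sigma']
  refine Finset.sum_involution (fun p _ => ⟨p.2, p.1⟩) ?_ ?_ ?_ ?_
  · rintro ⟨v, u⟩ h
    simp only [Finset.mem_sigma, Finset.mem_compl, Finset.mem_insert, not_or] at h
    obtain ⟨hv, huv, hu⟩ := h
    dsimp only
    rw [Finset.insert_comm v u, smul_comm (X v : MvPolynomial V k) (koszulSign u (insert v S)),
      smul_comm (X u : MvPolynomial V k) (koszulSign v (insert u S)),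
      smul_comm (X v : MvPolynomial V k) (X u : MvPolynomial V k), ← mul_smul,
      ← mul_smul (koszulSign u S), ← add_smul, koszulSign_swap hu hv huv, zero_smul]
  · rintro ⟨v, u⟩ h _
    simp only [Finset.mem_sigma, Finset.mem_compl, Finset.mem_insert, not_or] at h
    intro e
    exact h.2.1 (congrArg Sigma.fst e)
  · rintro ⟨v, u⟩ h
    simp only [Finset.mem_sigma, Finset.mem_compl, Finset.mem_insert, not_or] at h ⊢
    exact ⟨h.2.2, Ne.symm h.2.1, h.1⟩
  · rintro ⟨v, u⟩ h
    rfl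

theorem koszulD_koszulMap
    (φ : (ι →₀ MvPolynomial V k) →ₗ[MvPolynomial V k] (κ →₀ MvPolynomial V k))
    (f : Finset V → ι →₀ MvPolynomial V k) :
    koszulD k V κ (koszulMap φ f) = koszulMap φ (koszulD k V ι f) := by
  funext S
  simp only [koszulD_apply, koszulMap_apply, map_sum, map_smul, map_zsmul]

/-- If `W'` contains `x_v W` for all `v`, the differential maps `Λ^{q+1}(V) ⊗ W` to
`Λ^q(V) ⊗ W'`. -/
theorem koszulD_mem {W W' : Submodule k (ι →₀ MvPolynomial V k)} {q : ℕ}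
    (hW : ∀ v : V, ∀ g ∈ W, (X v : MvPolynomial V k) • g ∈ W')
    {f : Finset V → ι →₀ MvPolynomial V k} (hf : f ∈ koszulPiece W (q + 1)) :
    koszulD k V ι f ∈ koszulPiece W' q := by
  rw [mem_koszulPiece] at hf ⊢
  refine ⟨fun S => ?_, fun S hS => ?_⟩
  · exact W'.sum_mem fun v _ => W'.toAddSubgroup.zsmul_mem (hW v _ (hf.1 _)) _
  · refine Finset.sum_eq_zero fun v hv => ?_
    rw [hf.2, smul_zero, smul_zero]
    rw [Finset.card_insert_of_notMem (Finset.mem_compl.1 hv)]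
    omega

/-- The coefficient extraction used in the contracting homotopy: keep the terms `x_v x^a` of a
polynomial such that `a` involves no variable below `v`, and divide them by `x_v`. -/
theorem exists_lowDiv (v : V) (f : ι →₀ MvPolynomial V k) :
    ∃ g : ι →₀ MvPolynomial V k, ∀ b a, coeff a (g b) =
      if ∀ u < v, a u = 0 then coeff (Finsupp.single v 1 + a) (f b) else 0 := by
  classical
  let T : MvPolynomial V k → MvPolynomial V k := fun p =>
    ∑ a ∈ (p.divMonomial (Finsupp.single v 1)).support.filter (fun a => ∀ u < v, a u = 0),
      monomial a (coeff (Finsupp.single v 1 + a) p)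
  have hT : ∀ p a, coeff a (T p) =
      if ∀ u < v, a u = 0 then coeff (Finsupp.single v 1 + a) p else 0 := by
    intro p a
    simp only [T, coeff_sum, coeff_monomial, Finset.sum_ite_eq', Finset.mem_filter,
      MvPolynomial.mem_support_iff, coeff_divMonomial]
    by_cases h : ∀ u < v, a u = 0
    · by_cases h2 : coeff (Finsupp.single v 1 + a) p = 0
      · simp [h2]
      · simp [h2]
    · simp [h]
  have hT0 : T 0 = 0 := MvPolynomial.ext _ _ fun a => by rw [hT]; simp
  exact ⟨f.mapRange T hT0, fun b a => by rw [Finsupp.mapRange_apply, hT]⟩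

end Koszul

/-! ### Acyclicity for free modules and dimension shifting -/

section KoszulHomology

variable {V : Type u} {k : Type v} [Field k] [LinearOrder V] [Fintype V] {ι κ μ : Type w}

/-- The value at `S` of the contracting homotopy of the Koszul complex of a free module. -/
theorem exists_koszulHomotopy (y : Finset V → ι →₀ MvPolynomial V k) (S : Finset V) :
    ∃ g : ι →₀ MvPolynomial V k, (S = ∅ → g = 0) ∧ ∀ v ∈ S, (∀ u ∈ S, v ≤ u) → ∀ b a,
      coeff a (g b) = if ∀ u < v, a u = 0 then
        coeff (Finsupp.single v 1 + a) (y (S.erase v) b) else 0 := by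
  rcases S.eq_empty_or_nonempty with rfl | hS
  · exact ⟨0, fun _ => rfl, fun v hv => absurd hv (Finset.notMem_empty v)⟩
  · obtain ⟨g, hg⟩ := exists_lowDiv (S.min' hS) (y (S.erase (S.min' hS)))
    refine ⟨g, fun h => absurd h hS.ne_empty, fun v hv hmin => ?_⟩
    obtain rfl : v = S.min' hS := le_antisymm (hmin _ (S.min'_mem hS)) (S.min'_le v hv)
    exact hg

/-- The Koszul complex of a graded free module is exact, apart from the constants in degree zero. -/
theorem exists_koszulD_eq {deg : ι → ℕ} {n q : ℕ} {y : Finset V → ι →₀ MvPolynomial V k}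
    (hy : y ∈ koszulPiece (homPiece k V deg (n + 1)) q) (hd : koszulD k V ι y = 0)
    (h0 : q ≠ 0 ∨ ∀ b, coeff 0 (y ∅ b) = 0) :
    ∃ z ∈ koszulPiece (homPiece k V deg n) (q + 1), koszulD k V ι z = y := by
  -- The homotopy moves the smallest variable of a term from the polynomial to the exterior factor:
  -- `x_v x^a e_T` goes to `x^a e_{T ∪ v}` if `v` is the least index present and `v ∉ T`; other
  -- terms go to zero.
  choose z hz0 hz using exists_koszulHomotopy y
  rw [mem_koszulPiece] at hy
  refine ⟨z, mem_koszulPiece.2 ⟨fun S => ?_, fun S hS => ?_⟩, ?_⟩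
  · rcases S.eq_empty_or_nonempty with rfl | hne
    · rw [hz0 _ rfl]
      exact Submodule.zero_mem _
    · rw [mem_homPiece]
      intro b a ha
      rw [hz S _ (S.min'_mem hne) (fun u hu => S.min'_le u hu)] at ha
      split_ifs at ha
      · have h := hy.1 _ b _ ha
        rw [map_add, Finsupp.degree_single] at h
        omega
      · exact absurd rfl ha
  · rcases S.eq_empty_or_nonempty with rfl | hne
    · exact hz0 _ rfl
    · refine vec_ext fun b a => ?_
      rw [hz S _ (S.min'_mem hne) (fun u hu => S.min'_le u hu), hy.2]
      · simp
      · rw [Finset.card_erase_of_mem (S.min'_mem hne)]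
        have := hne.card_pos
        omega
  · funext S
    refine vec_ext fun b a => ?_
    rw [coeff_koszulD]
    rcases (S ∪ a.support).eq_empty_or_nonempty with hQ | hQ
    · rw [Finset.union_eq_empty] at hQ
      obtain ⟨rfl, ha⟩ := hQ
      rw [Finsupp.support_eq_empty] at ha
      subst ha
      have : coeff 0 (y ∅ b) = 0 := by
        rcases h0 with h0 | h0
        · rw [hy.2 _ (by simpa using h0.symm)]
          simp
        · exact h0 b
      rw [this]
      simp
    -- The term `x^a e_S` is treated according to where its least index `v` sits.
    · obtain ⟨v, hvQ, hvmin⟩ : ∃ v ∈ S ∪ a.support, ∀ u ∈ S ∪ a.support, v ≤ u :=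
        ⟨_, Finset.min'_mem _ hQ, fun u hu => Finset.min'_le _ u hu⟩
      have hlow : ∀ u < v, a u = 0 := by
        intro u hu
        by_contra h
        exact (hvmin u (Finset.mem_union_right _ (Finsupp.mem_support_iff.2 h))).not_gt hu
      by_cases hvS : v ∈ S
      -- If `v ∈ S`, the cycle condition at `x_v x^a e_{S \ v}` expresses the coefficient of `y` by
      -- the terms with `u ∉ S`. They match those of `∂z` up to the sign caused by `v < u`.
      · have e1 := coeff_koszulD y (S.erase v) b (Finsupp.single v 1 + a)
        rw [hd, Finset.compl_erase, Finset.sum_insert (by simpa using hvS),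
          Finset.insert_erase hvS, add_tsub_cancel_left,
          koszulSign_eq_one (fun u hu => hvmin u
            (Finset.mem_union_left _ (Finset.mem_of_mem_erase hu))),
          if_pos (by simp)] at e1
        simp only [Pi.zero_apply, Finsupp.coe_zero, coeff_zero, Int.cast_one, one_mul] at e1
        rw [← sub_eq_zero, ← neg_eq_zero, neg_sub, sub_eq_add_neg, ← Finset.sum_neg_distrib]
        refine Eq.trans ?_ e1.symm
        congr 1
        refine Finset.sum_congr rfl fun u hu => ?_
        have huS := Finset.mem_compl.1 hu
        have huv : u ≠ v := fun h => huS (h ▸ hvS)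
        by_cases hua : u ∈ a.support
        · have hvu : v < u := lt_of_le_of_ne (hvmin u (Finset.mem_union_right _ hua)) huv.symm
          rw [if_pos hua, if_pos (by simpa [Finsupp.single_apply, huv.symm] using hua),
            hz (insert u S) v (Finset.mem_insert_of_mem hvS), if_pos,
            Finset.erase_insert_of_ne huv]
          · have hs := koszulSign_insert (v := u) (Finset.notMem_erase v S)
            rw [Finset.insert_erase hvS, if_pos hvu] at hs
            rw [hs, add_tsub_assoc_of_le]
            · push_cast
              ring
            · exact Finsupp.single_le_iff.2 (Nat.one_le_iff_ne_zero.2 (Finsupp.mem_support_iff.1 hua))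
          · intro t ht
            simp [hlow t ht]
          · intro t ht
            rcases Finset.mem_insert.1 ht with rfl | ht
            · exact hvu.le
            · exact hvmin t (Finset.mem_union_left _ ht)
        · rw [if_neg hua, if_neg (by simpa [Finsupp.single_apply, huv.symm] using hua)]
          simp
      -- If `v ∉ S`, only the summand `v` survives: for `u ≠ v` the set `S ∪ u` has minimum above
      -- `v`, while `v` still occurs in the monomial.
      · have hva : v ∈ a.support := (Finset.mem_union.1 hvQ).resolve_left hvS
        rw [Finset.sum_eq_single v]
        · rw [if_pos hva, hz (insert v S) v (Finset.mem_insert_self v S), if_pos,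
            Finset.erase_insert hvS, koszulSign_eq_one, add_tsub_cancel_of_le]
          · simp
          · exact Finsupp.single_le_iff.2 (Nat.one_le_iff_ne_zero.2 (Finsupp.mem_support_iff.1 hva))
          · exact fun u hu => hvmin u (Finset.mem_union_left _ hu)
          · intro t ht
            simp [hlow t ht]
          · intro t ht
            rcases Finset.mem_insert.1 ht with rfl | ht
            · exact le_rfl
            · exact hvmin t (Finset.mem_union_left _ ht)
        · intro u hu huv
          by_cases hua : u ∈ a.support
          · have hne : (insert u S).Nonempty := Finset.insert_nonempty u S
            rw [if_pos hua, hz (insert u S) _ (Finset.min'_mem _ hne)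
              (fun t ht => Finset.min'_le _ t ht), if_neg, mul_zero]
            intro h
            have hlt : v < (insert u S).min' hne := by
              rw [Finset.lt_min'_iff]
              intro t ht
              rcases Finset.mem_insert.1 ht with rfl | ht
              · exact lt_of_le_of_ne (hvmin _ (Finset.mem_union_right _ hua)) huv.symm
              · exact lt_of_le_of_ne (hvmin t (Finset.mem_union_left _ ht)) fun e => hvS (e ▸ ht)
            have := h v hlt
            simp [huv] at this
            exact Finsupp.mem_support_iff.1 hva this
          · rw [if_neg hua, mul_zero]
        · exact fun h => absurd (Finset.mem_compl.2 hvS) h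

/-- The homology of `Λ^{q+1}(V) ⊗ W n → Λ^q(V) ⊗ W (n+1) → Λ^{q-1}(V) ⊗ W (n+2)`. -/
def koszulHomology (W : ℕ → Submodule k (ι →₀ MvPolynomial V k)) (q n : ℕ) :
    Submodule k ((Finset V → ι →₀ MvPolynomial V k) ⧸
      (koszulPiece (W n) (q + 1)).map (koszulD k V ι)) :=
  (koszulPiece (W (n + 1)) q ⊓ LinearMap.ker (koszulD k V ι)).map (Submodule.mkQ _)

theorem koszulD_homPiece {deg : ι → ℕ} {n q : ℕ} {f : Finset V → ι →₀ MvPolynomial V k}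
    (hf : f ∈ koszulPiece (homPiece k V deg n) (q + 1)) :
    koszulD k V ι f ∈ koszulPiece (homPiece k V deg (n + 1)) q :=
  koszulD_mem (fun v _ hg => X_smul_mem_homPiece v hg) hf

/-- Dimension shifting along a short exact sequence `0 → ker φ → F → im φ → 0`. -/
theorem rank_koszulHomology_shift {deg : ι → ℕ} {deg' : κ → ℕ}
    {ψ : (ι →₀ MvPolynomial V k) →ₗ[MvPolynomial V k] (κ →₀ MvPolynomial V k)}
    {φ : (κ →₀ MvPolynomial V k) →ₗ[MvPolynomial V k] (μ →₀ MvPolynomial V k)}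
    (hψ : IsGradedMap deg deg' ψ) (h : Function.Exact ψ φ) (q n : ℕ) :
    Module.rank k (koszulHomology (imPiece deg' φ) (q + 2) n) =
      Module.rank k (koszulHomology (imPiece deg ψ) (q + 1) (n + 1)) := by
  -- The connecting homomorphism as a correspondence: lift a cycle of `im φ` to `y` over the free
  -- module, then take `∂y`, which lies in `ker φ = im ψ`. The differential trades one exterior
  -- degree for one polynomial degree.
  refine rank_map_mkQ_eq
    (koszulPiece (homPiece k V deg' (n + 1)) (q + 2) ⊓
      LinearMap.ker (koszulD k V _ ∘ₗ koszulMap φ)) (koszulMap φ) (koszulD k V κ) ?_ ?_ ?_ ?_ ?_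
  · rintro y ⟨hy, hy'⟩
    exact ⟨koszulMap_mem φ hy, hy'⟩
  · rintro y ⟨hy, hy'⟩
    refine ⟨(koszulPiece_imPiece_iff hψ h).2 ⟨koszulD_homPiece hy, ?_⟩, koszulD_koszulD y⟩
    rw [← koszulD_koszulMap]
    exact hy'
  · rintro a ⟨ha, ha'⟩
    obtain ⟨y, hy, rfl⟩ := exists_koszulMap_eq ha
    exact ⟨y, ⟨hy, ha'⟩, rfl⟩
  · rintro b ⟨hb, hb'⟩
    obtain ⟨hb1, hb2⟩ := (koszulPiece_imPiece_iff hψ h).1 hb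
    -- Exterior degree `q + 1` is positive, so the constants are no obstruction.
    obtain ⟨y, hy, rfl⟩ := exists_koszulD_eq hb1 hb' (Or.inl (Nat.succ_ne_zero q))
    exact ⟨y, ⟨hy, (koszulD_koszulMap φ y).trans hb2⟩, rfl⟩
  · rintro y ⟨hy, hy'⟩
    constructor
    · rintro ⟨a', ha', e⟩
      obtain ⟨y', hy1, rfl⟩ := exists_koszulMap_eq ha'
      refine ⟨y - koszulD k V κ y', (koszulPiece_imPiece_iff hψ h).2
        ⟨Submodule.sub_mem _ hy (koszulD_homPiece hy1), ?_⟩, ?_⟩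
      · rw [map_sub, ← koszulD_koszulMap, e, sub_self]
      · rw [map_sub, koszulD_koszulD, sub_zero]
    · rintro ⟨b', hb', e⟩
      obtain ⟨hb1, hb2⟩ := (koszulPiece_imPiece_iff hψ h).1 hb'
      obtain ⟨z, hz, e'⟩ := exists_koszulD_eq (Submodule.sub_mem _ hy hb1)
        (by rw [map_sub, e, sub_self]) (Or.inl (Nat.succ_ne_zero _))
      refine ⟨koszulMap φ z, koszulMap_mem φ hz, ?_⟩
      rw [koszulD_koszulMap, e', map_sub, hb2, sub_zero]

end KoszulHomology

/-! ### Reduction modulo the variables -/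

section ConstPart

variable {V : Type u} {k : Type v} [Field k] {ι κ : Type w}

/-- Reduction of a vector modulo the variables. -/
def constPart (k : Type v) [Field k] (V : Type u) (ι : Type w) :
    (ι →₀ MvPolynomial V k) →ₗ[k] (ι →₀ k) where
  toFun f := f.mapRange (constantCoeff (σ := V) (R := k)) (map_zero _)
  map_add' f g := Finsupp.ext fun b => by simp
  map_smul' c f := Finsupp.ext fun b => by simp [smul_eq_C_mul]

theorem constPart_apply (f : ι →₀ MvPolynomial V k) (b : ι) :
    constPart k V ι f b = coeff 0 (f b) := rfl

theorem constPart_smul (p : MvPolynomial V k) (f : ι →₀ MvPolynomial V k) :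
    constPart k V ι (p • f) = constantCoeff p • constPart k V ι f :=
  Finsupp.ext fun b => map_mul constantCoeff p (f b)

/-- Taking constant terms is multiplicative, so the matrix of constant terms represents the
reduction of `φ`. -/
theorem linearCombination_constPart
    (φ : (ι →₀ MvPolynomial V k) →ₗ[MvPolynomial V k] (κ →₀ MvPolynomial V k))
    (f : ι →₀ MvPolynomial V k) :
    Finsupp.linearCombination k (fun b => constPart k V κ (φ (Finsupp.single b 1)))
      (constPart k V ι f) = constPart k V κ (φ f) := by
  induction f using Finsupp.induction_linear with
  | zero => simp
  | add f g hf hg => rw [map_add, map_add, hf, hg, map_add, map_add]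
  | single b p =>
    have h1 : constPart k V ι (Finsupp.single b p) = Finsupp.single b (constantCoeff p) :=
      Finsupp.mapRange_single (hf := map_zero _)
    have h2 : (Finsupp.single b p : ι →₀ MvPolynomial V k) = p • Finsupp.single b 1 := by
      rw [Finsupp.smul_single, smul_eq_mul, mul_one]
    rw [h1, Finsupp.linearCombination_single, h2, map_smul, constPart_smul]

theorem constPart_mem_supported {deg : ι → ℕ} {n : ℕ} {f : ι →₀ MvPolynomial V k}
    (hf : f ∈ homPiece k V deg n) :
    constPart k V ι f ∈ Finsupp.supported k k {b | deg b = n} := by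
  rw [Finsupp.mem_supported]
  intro b hb
  have h := hf b 0 (Finsupp.mem_support_iff (f := constPart k V ι f).1 hb)
  rwa [map_zero, zero_add] at h

theorem exists_constPart_eq {deg : ι → ℕ} {n : ℕ} {c : ι →₀ k}
    (hc : c ∈ Finsupp.supported k k {b | deg b = n}) :
    ∃ f ∈ homPiece k V deg n, constPart k V ι f = c := by
  classical
  refine ⟨c.mapRange (C (σ := V)) (map_zero _), fun b m h => ?_, Finsupp.ext fun b => ?_⟩
  · rw [Finsupp.mapRange_apply, coeff_C] at h
    split_ifs at h with hm
    · subst hm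
      rw [map_zero, zero_add]
      exact (Finsupp.mem_supported _ _).1 hc (Finsupp.mem_support_iff.2 h)
    · exact absurd rfl h
  · rw [constPart_apply, Finsupp.mapRange_apply, coeff_zero_C]

variable [LinearOrder V]

/-- The embedding of `F` as `Λ^0(V) ⊗ F`. -/
def koszulSingle (k : Type v) [Field k] (V : Type u) [LinearOrder V] (ι : Type w) :
    (ι →₀ MvPolynomial V k) →ₗ[k] (Finset V → ι →₀ MvPolynomial V k) :=
  LinearMap.single k (fun _ : Finset V => ι →₀ MvPolynomial V k) ∅

theorem koszulSingle_empty (f : ι →₀ MvPolynomial V k) : koszulSingle k V ι f ∅ = f :=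
  Pi.single_eq_same (M := fun _ : Finset V => ι →₀ MvPolynomial V k) ∅ f

theorem koszulSingle_of_ne (f : ι →₀ MvPolynomial V k) {S : Finset V} (hS : S ≠ ∅) :
    koszulSingle k V ι f S = 0 :=
  Pi.single_eq_of_ne (M := fun _ : Finset V => ι →₀ MvPolynomial V k) hS f

theorem koszulSingle_mem {W : Submodule k (ι →₀ MvPolynomial V k)} {f : ι →₀ MvPolynomial V k}
    (hf : f ∈ W) : koszulSingle k V ι f ∈ koszulPiece W 0 := by
  refine mem_koszulPiece.2 ⟨fun S => ?_, fun S hS => ?_⟩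
  · by_cases hS : S = ∅
    · subst hS
      rwa [koszulSingle_empty]
    · rw [koszulSingle_of_ne f hS]
      exact W.zero_mem
  · exact koszulSingle_of_ne f fun e => hS (by rw [e, Finset.card_empty])

theorem koszulPiece_zero_ext {W : Submodule k (ι →₀ MvPolynomial V k)}
    {f g : Finset V → ι →₀ MvPolynomial V k} (hf : f ∈ koszulPiece W 0)
    (hg : g ∈ koszulPiece W 0) (h : f ∅ = g ∅) : f = g := by
  funext S
  by_cases hS : S = ∅
  · rw [hS, h]
  · rw [(mem_koszulPiece.1 hf).2 S (by simpa using hS),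
      (mem_koszulPiece.1 hg).2 S (by simpa using hS)]

variable [Fintype V]

theorem koszulD_koszulSingle (f : ι →₀ MvPolynomial V k) :
    koszulD k V ι (koszulSingle k V ι f) = 0 := by
  funext S
  refine Finset.sum_eq_zero fun v _ => ?_
  rw [koszulSingle_of_ne f (Finset.insert_ne_empty v S), smul_zero, smul_zero]

theorem constPart_koszulD (y : Finset V → ι →₀ MvPolynomial V k) (S : Finset V) :
    constPart k V ι (koszulD k V ι y S) = 0 := by
  refine Finsupp.ext fun b => ?_
  rw [constPart_apply, coeff_koszulD]
  simp

/-- Acyclicity in exterior degree zero, where the constant part is the only obstruction: such an `f`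
is a combination `∑ x_v g_v`. -/
theorem exists_koszulD_empty_eq {deg : ι → ℕ} {n : ℕ} {f : ι →₀ MvPolynomial V k}
    (hf : f ∈ homPiece k V deg (n + 1)) (h : constPart k V ι f = 0) :
    ∃ y ∈ koszulPiece (homPiece k V deg n) 1, koszulD k V ι y ∅ = f := by
  obtain ⟨y, hy, e⟩ := exists_koszulD_eq (koszulSingle_mem hf) (koszulD_koszulSingle f)
    (Or.inr fun b => by rw [koszulSingle_empty, ← constPart_apply, h, Finsupp.zero_apply])
  exact ⟨y, hy, by rw [e, koszulSingle_empty]⟩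

end ConstPart

/-! ### Balance of `Tor` -/

section Tor

variable {V : Type u} {k : Type v} [Field k] {I : Ideal (MvPolynomial V k)}
  (F : GradedFreeResolution I)

theorem dTensor_constPart (i : ℕ) (f : F.ι (i + 1) →₀ MvPolynomial V k) :
    F.dTensor i (constPart k V _ f) = constPart k V _ (F.d i f) :=
  linearCombination_constPart (F.d i) f

theorem isGradedMap_d (i : ℕ) : IsGradedMap (F.deg (i + 1)) (F.deg i) (F.d i) := F.d_homogeneous i

/-- Boundaries of `F ⊗ k` are tested on lifts, modulo the ideal of the variables. -/
theorem mem_boundaries_iff {i j : ℕ} {f : F.ι i →₀ MvPolynomial V k} :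
    constPart k V _ f ∈ F.boundaries i j ↔
      ∃ g ∈ homPiece k V (F.deg (i + 1)) j, constPart k V _ (f - F.d i g) = 0 := by
  constructor
  · rintro ⟨c, hc, e⟩
    obtain ⟨g, hg, rfl⟩ := exists_constPart_eq (V := V) hc
    exact ⟨g, hg, by rw [map_sub, ← dTensor_constPart, e, sub_self]⟩
  · rintro ⟨g, hg, e⟩
    refine ⟨constPart k V _ g, constPart_mem_supported hg, ?_⟩
    rw [map_sub, sub_eq_zero] at e
    rw [dTensor_constPart, e]

/-- The augmentation, with values in a free module of rank one. -/
def augVec : (F.ι 0 →₀ MvPolynomial V k) →ₗ[MvPolynomial V k]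
    (PUnit.{max u v + 1} →₀ MvPolynomial V k) :=
  Finsupp.lsingle PUnit.unit ∘ₗ F.aug

theorem isGradedMap_augVec : IsGradedMap (F.deg 0) (fun _ => 0) (augVec F) := by
  intro b c m h
  have h1 : coeff m (F.aug (Finsupp.single b 1)) ≠ 0 := by
    rwa [augVec, LinearMap.comp_apply, Finsupp.lsingle_apply, Finsupp.single_eq_same] at h
  have h2 := F.aug_homogeneous b h1
  rw [add_zero, Finsupp.degree_eq_weight_one]
  exact h2

theorem exact_d_augVec : Function.Exact (F.d 0) (augVec F) := by
  intro y
  rw [← F.exact_zero y]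
  exact Finsupp.single_eq_zero

variable [LinearOrder V] [Fintype V]

/-- The last step of the dimension shift: first Koszul homology of a syzygy module is `Tor`. -/
theorem rank_koszulHomology_one {κ : Type (max u v)} (s n : ℕ)
    {π : (F.ι s →₀ MvPolynomial V k) →ₗ[MvPolynomial V k] (κ →₀ MvPolynomial V k)}
    (h : Function.Exact (F.d s) π) :
    Module.rank k (koszulHomology (imPiece (F.deg s) π) 1 n) =
      Module.rank k (F.tor (s + 1) (n + 2)) := by
  let δ : (F.ι (s + 1) →₀ MvPolynomial V k) →ₗ[k] (F.ι s →₀ MvPolynomial V k) :=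
    (F.d s).restrictScalars k
  -- Pairs `(y, w)` with `∂y = d w` in `F_s`: `y` lifts a Koszul 1-cycle of `im π`, and `w` lifts a
  -- cycle of `F ⊗ k`.
  let Y₀ : Submodule k ((Finset V → F.ι s →₀ MvPolynomial V k) ×
      (F.ι (s + 1) →₀ MvPolynomial V k)) :=
    (koszulPiece (homPiece k V (F.deg s) (n + 1)) 1).prod (homPiece k V (F.deg (s + 1)) (n + 2)) ⊓
      LinearMap.ker (LinearMap.proj ∅ ∘ₗ koszulD k V _ ∘ₗ LinearMap.fst k _ _ -
        δ ∘ₗ LinearMap.snd k _ _)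
  have hY : ∀ y w, (y, w) ∈ Y₀ ↔ y ∈ koszulPiece (homPiece k V (F.deg s) (n + 1)) 1 ∧
      w ∈ homPiece k V (F.deg (s + 1)) (n + 2) ∧ koszulD k V _ y ∅ = F.d s w := by
    intro y w
    rw [Submodule.mem_inf, Submodule.mem_prod, and_assoc, LinearMap.mem_ker]
    exact and_congr_right' (and_congr_right' sub_eq_zero)
  have hgr := isGradedMap_d F s
  have hex : ∀ w, π (F.d s w) = 0 := fun w => (h _).2 ⟨w, rfl⟩
  have hdd : ∀ g, F.d s (F.d (s + 1) g) = 0 := fun g => (F.exact_succ s _).2 ⟨g, rfl⟩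
  refine rank_map_mkQ_eq Y₀ (koszulMap π ∘ₗ LinearMap.fst k _ _)
    (constPart k V _ ∘ₗ LinearMap.snd k _ _) ?_ ?_ ?_ ?_ ?_
  · rintro ⟨y, w⟩ hyw
    obtain ⟨hy, hw, e⟩ := (hY y w).1 hyw
    refine ⟨koszulMap_mem π hy, ?_⟩
    change koszulD k V _ (koszulMap π y) = 0
    rw [koszulD_koszulMap]
    refine koszulPiece_zero_ext (koszulMap_mem π (koszulD_homPiece hy)) (Submodule.zero_mem _) ?_
    rw [koszulMap_apply, e, hex, Pi.zero_apply]
  · rintro ⟨y, w⟩ hyw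
    obtain ⟨hy, hw, e⟩ := (hY y w).1 hyw
    refine ⟨constPart_mem_supported hw, ?_⟩
    change F.dTensor s (constPart k V _ w) = 0
    rw [dTensor_constPart, ← e, constPart_koszulD]
  · rintro a ⟨ha, ha'⟩
    obtain ⟨y, hy, rfl⟩ := exists_koszulMap_eq ha
    have hd := koszulD_homPiece hy
    obtain ⟨w, hw, e⟩ := hgr.exists_preimage ((mem_koszulPiece.1 hd).1 ∅) ((h _).1 (by
      rw [← koszulMap_apply, ← koszulD_koszulMap]
      exact congrFun ha' ∅))
    exact ⟨(y, w), (hY y w).2 ⟨hy, hw, e.symm⟩, rfl⟩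
  · rintro c ⟨hc, hc'⟩
    obtain ⟨w, hw, rfl⟩ := exists_constPart_eq (V := V) hc
    obtain ⟨y, hy, e⟩ := exists_koszulD_empty_eq (hgr.map_mem hw) (by
      rw [← dTensor_constPart]
      exact hc')
    exact ⟨(y, w), (hY y w).2 ⟨hy, hw, e⟩, rfl⟩
  · rintro ⟨y, w⟩ hyw
    obtain ⟨hy, hw, e⟩ := (hY y w).1 hyw
    change koszulMap π y ∈ _ ↔ constPart k V _ w ∈ _
    rw [mem_boundaries_iff]
    constructor
    · rintro ⟨a', ha', ea⟩
      obtain ⟨y', hy', rfl⟩ := exists_koszulMap_eq ha'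
      have h1 : y - koszulD k V _ y' ∈ koszulPiece (imPiece (F.deg (s + 1)) (F.d s) (n + 1)) 1 := by
        refine (koszulPiece_imPiece_iff hgr h).2
          ⟨Submodule.sub_mem _ hy (koszulD_homPiece hy'), ?_⟩
        rw [map_sub, ← koszulD_koszulMap, ea, sub_self]
      -- Now `y - ∂y' = d t`, so `w - ∂t` is killed by `d` and equals some `d g`; and `∂t` has no
      -- constant part.
      obtain ⟨t, ht, et⟩ := exists_koszulMap_eq h1
      have h2 : F.d s (w - koszulD k V _ t ∅) = 0 := by
        rw [map_sub, ← e, ← koszulMap_apply, ← koszulD_koszulMap, et, map_sub, koszulD_koszulD,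
          sub_zero, sub_self]
      obtain ⟨g, hg, eg⟩ := (isGradedMap_d F (s + 1)).exists_preimage
        (Submodule.sub_mem _ hw ((mem_koszulPiece.1 (koszulD_homPiece ht)).1 ∅))
        ((F.exact_succ s _).1 h2)
      exact ⟨g, hg, by rw [eg, sub_sub_cancel, constPart_koszulD]⟩
    · rintro ⟨g, hg, eg⟩
      -- Conversely `w - d g = ∂t`, so `y - d t` is a Koszul cycle over a free module, hence a
      -- boundary `∂z`; applying `π` removes `d t`.
      obtain ⟨t, ht, et⟩ := exists_koszulD_empty_eq
        (Submodule.sub_mem _ hw ((isGradedMap_d F (s + 1)).map_mem hg)) eg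
      have ht' : koszulMap (F.d s) t ∈ koszulPiece (homPiece k V (F.deg s) (n + 1)) 1 :=
        ((koszulPiece_imPiece_iff hgr h).1 (koszulMap_mem (F.d s) ht)).1
      have hsub := Submodule.sub_mem _ hy ht'
      obtain ⟨z, hz, ez⟩ := exists_koszulD_eq hsub (by
        refine koszulPiece_zero_ext (koszulD_homPiece hsub) (Submodule.zero_mem _) ?_
        rw [map_sub, koszulD_koszulMap, Pi.sub_apply, koszulMap_apply, et, e, map_sub, hdd,
          sub_zero, sub_self, Pi.zero_apply]) (Or.inl one_ne_zero)
      refine ⟨koszulMap π z, koszulMap_mem π hz, ?_⟩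
      rw [koszulD_koszulMap, ez, map_sub, ((koszulPiece_imPiece_iff hgr h).1
        (koszulMap_mem (F.d s) ht)).2, sub_zero]

/-- The shift is applied `s + 1` times, once for each of the maps `augVec F`, `d 0`, ..., `d (s -
1)` and with `d s` as the last syzygy. -/
theorem rank_koszulHomology_shift_iterate (s q n : ℕ) :
    Module.rank k (koszulHomology (imPiece (F.deg 0) (augVec F)) (q + s + 2) n) =
      Module.rank k (koszulHomology (imPiece (F.deg (s + 1)) (F.d s)) (q + 1) (n + s + 1)) := by
  induction s generalizing q with
  | zero => exact rank_koszulHomology_shift (isGradedMap_d F 0) (exact_d_augVec F) q n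
  | succ s ih =>
    rw [show q + (s + 1) + 2 = (q + 1) + s + 2 by omega, ih,
      rank_koszulHomology_shift (isGradedMap_d F (s + 1)) (F.exact_succ s)]
    rfl

/-- Both sides are the degree `n + 1` part of `I ⊗ k`, by right exactness. -/
theorem rank_koszulHomology_zero (n : ℕ) :
    Module.rank k (koszulHomology (imPiece (F.deg 0) (augVec F)) 0 n) =
      Module.rank k (F.tor 0 (n + 1)) := by
  have hdd : ∀ g, augVec F (F.d 0 g) = 0 := fun g => (exact_d_augVec F _).2 ⟨g, rfl⟩
  refine rank_map_mkQ_eq (homPiece k V (F.deg 0) (n + 1))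
    (koszulSingle k V _ ∘ₗ (augVec F).restrictScalars k)
    (constPart k V _) (fun w hw => ⟨koszulSingle_mem ⟨w, hw, rfl⟩, koszulD_koszulSingle _⟩)
    (fun w hw => constPart_mem_supported hw) ?_ (fun c hc => exists_constPart_eq hc) ?_
  · rintro a ⟨ha, -⟩
    obtain ⟨w, hw, e⟩ := (mem_koszulPiece.1 ha).1 ∅
    refine ⟨w, hw, koszulPiece_zero_ext (koszulSingle_mem (Submodule.mem_map_of_mem hw)) ha ?_⟩
    exact (koszulSingle_empty _).trans e
  · intro w hw
    rw [mem_boundaries_iff]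
    constructor
    · rintro ⟨a', ha', ea⟩
      obtain ⟨t, ht, rfl⟩ := exists_koszulMap_eq ha'
      have h2 : augVec F (w - koszulD k V _ t ∅) = 0 := by
        rw [map_sub, ← koszulMap_apply, ← koszulD_koszulMap, ea]
        exact sub_eq_zero.2 (koszulSingle_empty _).symm
      obtain ⟨g, hg, eg⟩ := (isGradedMap_d F 0).exists_preimage
        (Submodule.sub_mem _ hw ((mem_koszulPiece.1 (koszulD_homPiece ht)).1 ∅))
        ((exact_d_augVec F _).1 h2)
      exact ⟨g, hg, by rw [eg, sub_sub_cancel, constPart_koszulD]⟩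
    · rintro ⟨g, hg, eg⟩
      obtain ⟨t, ht, et⟩ := exists_koszulD_empty_eq
        (Submodule.sub_mem _ hw ((isGradedMap_d F 0).map_mem hg)) eg
      refine ⟨koszulMap (augVec F) t, koszulMap_mem _ ht, ?_⟩
      rw [koszulD_koszulMap]
      refine koszulPiece_zero_ext (koszulMap_mem _ (koszulD_homPiece ht))
        (koszulSingle_mem ⟨w, hw, rfl⟩) ?_
      rw [koszulMap_apply, et, map_sub, hdd, sub_zero]
      exact (koszulSingle_empty _).symm

/-- Balance of `Tor`: graded Betti numbers are computed by Koszul homology. -/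
theorem rank_tor_eq_rank_koszulHomology (i n : ℕ) :
    Module.rank k (F.tor i (n + i + 1)) =
      Module.rank k (koszulHomology (imPiece (F.deg 0) (augVec F)) i n) := by
  match i with
  | 0 => exact (rank_koszulHomology_zero F n).symm
  | 1 => exact (rank_koszulHomology_one F 0 n (exact_d_augVec F)).symm
  | s + 2 =>
    have h := rank_koszulHomology_shift_iterate F s 0 n
    rw [zero_add] at h
    rw [h, rank_koszulHomology_one F (s + 1) (n + s + 1) (F.exact_succ s)]
    rfl

end Tor

/-- Applied with `ev` reading off selected coefficients of a cycle. -/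
theorem rank_eq_card {k : Type v} [Field k] {A : Type w} [AddCommGroup A] [Module k A]
    {J : Type u} [Fintype J] {Z : Submodule k A} (ev : A →ₗ[k] (J → k))
    (hinj : ∀ f ∈ Z, ev f = 0 → f = 0) (hsurj : ∀ x, ∃ f ∈ Z, ev f = x) :
    Module.rank k Z = Fintype.card J := by
  have hb : Function.Bijective (ev.domRestrict Z) := by
    constructor
    · rw [injective_iff_map_eq_zero]
      exact fun f hf => Subtype.ext (hinj f.1 f.2 hf)
    · intro x
      obtain ⟨f, hf, e⟩ := hsurj x
      exact ⟨⟨f, hf⟩, e⟩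
  have h := (LinearEquiv.ofBijective (ev.domRestrict Z) hb).lift_rank_eq
  rw [rank_fun', Cardinal.lift_natCast] at h
  exact Cardinal.lift_injective (h.trans (Cardinal.lift_natCast _).symm)

/-! ### Forests and the low degrees of the edge ideal -/

section Graph

variable {V : Type u} {G : SimpleGraph V}

/-- No triangles: paths with given ends are unique. -/
theorem not_adj_of_isAcyclic (hG : G.IsAcyclic) {a b c : V} (hab : G.Adj a b) (hbc : G.Adj b c) :
    ¬ G.Adj a c := by
  intro hac
  have h := (hG.subsingleton_path _ _).elim ⟨.cons hac .nil, by simp [hac.ne]⟩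
    ⟨.cons hab (.cons hbc .nil), by simp [hab.ne, hbc.ne, hac.ne]⟩
  simpa using congrArg (fun p => p.1.length) h

/-- No 4-cycles, again by uniqueness of paths. -/
theorem eq_of_isAcyclic (hG : G.IsAcyclic) {a b b' c : V} (hac : a ≠ c) (hab : G.Adj a b)
    (hbc : G.Adj b c) (hab' : G.Adj a b') (hbc' : G.Adj b' c) : b = b' := by
  have h := (hG.subsingleton_path _ _).elim ⟨.cons hab (.cons hbc .nil), by simp [hab.ne, hbc.ne, hac]⟩
    ⟨.cons hab' (.cons hbc' .nil), by simp [hab'.ne, hbc'.ne, hac]⟩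
  simpa using congrArg (fun p => p.1.support) h

/-- The exponent of the monomial `x_a x_b` attached to an edge. -/
def edgeExponent : Sym2 V → V →₀ ℕ :=
  Sym2.lift ⟨fun a b => Finsupp.single a 1 + Finsupp.single b 1, fun _ _ => add_comm _ _⟩

theorem edgeExponent_mk (a b : V) :
    edgeExponent s(a, b) = Finsupp.single a 1 + Finsupp.single b 1 := rfl

theorem edgeExponent_injective : Function.Injective (edgeExponent (V := V)) := by
  intro e e'
  induction e using Sym2.ind with | _ a b =>
  induction e' using Sym2.ind with | _ c d =>
  intro h
  rw [edgeExponent_mk, edgeExponent_mk,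
    Finsupp.single_add_single_eq_single_add_single one_ne_zero one_ne_zero] at h
  rw [Sym2.eq_iff]
  rcases h with ⟨h1, h2⟩ | ⟨-, h1, h2⟩ | ⟨h, -⟩
  · exact Or.inl ⟨h1, h2⟩
  · exact Or.inr ⟨h1, h2⟩
  · exact absurd h (by norm_num)

theorem degree_edgeExponent (e : Sym2 V) : (edgeExponent e).degree = 2 := by
  induction e using Sym2.ind with | _ a b =>
  rw [edgeExponent_mk, map_add, Finsupp.degree_single, Finsupp.degree_single]

variable {k : Type v} [Field k]

theorem monomial_edgeExponent (a b : V) :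
    monomial (edgeExponent s(a, b)) (1 : k) = X a * X b := by
  rw [edgeExponent_mk, X, X, monomial_mul, mul_one]

theorem mem_edgeIdeal_iff {p : MvPolynomial V k} :
    p ∈ (edgeIdeal k G).toIdeal ↔ ∀ m ∈ p.support, ∃ e ∈ G.edgeSet, edgeExponent e ≤ m := by
  have h : (edgeIdeal k G).toIdeal =
      Ideal.span ((fun m => monomial m (1 : k)) '' (edgeExponent '' G.edgeSet)) := by
    change Ideal.span _ = _
    congr 1
    ext p
    constructor
    · rintro ⟨a, b, hab, rfl⟩
      exact ⟨_, ⟨s(a, b), hab, rfl⟩, monomial_edgeExponent a b⟩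
    · rintro ⟨_, ⟨e, he, rfl⟩, rfl⟩
      induction e using Sym2.ind with | _ a b =>
      exact ⟨a, b, he, monomial_edgeExponent a b⟩
  rw [h, mem_ideal_span_monomial_image]
  simp

variable (F : GradedFreeResolution (edgeIdeal k G).toIdeal)

theorem mem_imPiece_augVec_iff {n : ℕ} {g : PUnit.{max u v + 1} →₀ MvPolynomial V k} :
    g ∈ imPiece (F.deg 0) (augVec F) n ↔ ∀ m, coeff m (g PUnit.unit) ≠ 0 →
      m.degree = n ∧ ∃ e ∈ G.edgeSet, edgeExponent e ≤ m := by
  have h1 : g ∈ imPiece (F.deg 0) (augVec F) n ↔ g ∈ homPiece k V (fun _ => 0) n ∧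
      g PUnit.unit ∈ LinearMap.range F.aug := by
    constructor
    · rintro ⟨f, hf, rfl⟩
      refine ⟨(isGradedMap_augVec F).map_mem hf, f, ?_⟩
      exact (Finsupp.single_eq_same).symm
    · rintro ⟨h1, f, h2⟩
      obtain ⟨f', hf', e⟩ := (isGradedMap_augVec F).exists_preimage h1
        ⟨f, Finsupp.ext fun _ => (Finsupp.single_eq_same).trans h2⟩
      exact ⟨f', hf', e⟩
  rw [h1, F.range_aug, mem_homPiece, mem_edgeIdeal_iff]
  simp only [MvPolynomial.mem_support_iff, add_zero]
  exact ⟨fun h m hm => ⟨h.1 PUnit.unit m hm, h.2 m hm⟩,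
    fun h => ⟨fun _ m hm => (h m hm).1, fun m hm => (h m hm).2⟩⟩

theorem imPiece_augVec_one : imPiece (F.deg 0) (augVec F) 1 = ⊥ := by
  rw [eq_bot_iff]
  intro g hg
  rw [mem_imPiece_augVec_iff] at hg
  refine (Submodule.mem_bot k).2 (vec_ext fun _ m => ?_)
  by_contra h
  obtain ⟨hm, e, -, he⟩ := hg m h
  have := Finsupp.degree_mono he
  rw [degree_edgeExponent] at this
  omega

theorem mem_imPiece_augVec_two {g : PUnit.{max u v + 1} →₀ MvPolynomial V k} :
    g ∈ imPiece (F.deg 0) (augVec F) 2 ↔ ∀ m, coeff m (g PUnit.unit) ≠ 0 →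
      ∃ e ∈ G.edgeSet, m = edgeExponent e := by
  rw [mem_imPiece_augVec_iff]
  refine forall₂_congr fun m _ => ⟨?_, ?_⟩
  · rintro ⟨hm, e, he, hle⟩
    refine ⟨e, he, ?_⟩
    have h := congrArg Finsupp.degree (add_tsub_cancel_of_le hle)
    rw [map_add, degree_edgeExponent, hm] at h
    have h0 : m - edgeExponent e = 0 := (Finsupp.degree_eq_zero_iff _).1 (by omega)
    exact le_antisymm (tsub_eq_zero_iff_le.1 h0) hle
  · rintro ⟨e, he, rfl⟩
    exact ⟨degree_edgeExponent e, e, he, le_rfl⟩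

/-- A Koszul chain with coefficients in the span of the edge monomials. -/
def IsEdgeChain (G : SimpleGraph V) (f : Finset V → PUnit.{w + 1} →₀ MvPolynomial V k) : Prop :=
  ∀ S m, coeff m (f S PUnit.unit) ≠ 0 → ∃ e ∈ G.edgeSet, m = edgeExponent e

theorem IsEdgeChain.adj {f : Finset V → PUnit.{w + 1} →₀ MvPolynomial V k} (hf : IsEdgeChain G f)
    {S : Finset V} {a b : V} (h : coeff (edgeExponent s(a, b)) (f S PUnit.unit) ≠ 0) :
    G.Adj a b := by
  obtain ⟨e, he, h⟩ := hf S _ h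
  rwa [← edgeExponent_injective h] at he

theorem isEdgeChain_of_mem {i : ℕ} {f : Finset V → PUnit.{max u v + 1} →₀ MvPolynomial V k}
    (hf : f ∈ koszulPiece (imPiece (F.deg 0) (augVec F) 2) i) : IsEdgeChain G f :=
  fun S => (mem_imPiece_augVec_two F).1 ((mem_koszulPiece.1 hf).1 S)

variable [LinearOrder V] [Fintype V]

/-! ### Linear Koszul cycles on a forest -/

section Cycles

variable {f : Finset V → PUnit.{w + 1} →₀ MvPolynomial V k}

theorem IsEdgeChain.notMem (hf : IsEdgeChain G f) (hd : koszulD k V _ f = 0) {S : Finset V}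
    {a b : V} (h : coeff (edgeExponent s(a, b)) (f S PUnit.unit) ≠ 0) : a ∉ S := by
  intro ha
  have hab := hf.adj h
  -- In the coefficient of `x_a² x_b` at `e_{S \ a}`, the only other possible contribution would
  -- need the non-edge monomial `x_a²`.
  have h1 := coeff_koszulD f (S.erase a) PUnit.unit
    (Finsupp.single a 1 + edgeExponent s(a, b))
  rw [hd, Finset.sum_eq_single a, Finset.insert_erase ha, if_pos (by simp),
    add_tsub_cancel_left] at h1
  · exact mul_ne_zero (koszulSign_ne_zero _ _) h h1.symm
  · intro c _ hca
    split_ifs with hc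
    · have hcb : c = b := by
        by_contra hcb
        simp [edgeExponent_mk, hca.symm, Ne.symm hcb] at hc
      subst hcb
      have h2 : Finsupp.single a 1 + edgeExponent s(a, c) - Finsupp.single c 1 =
          edgeExponent s(a, a) := by
        rw [edgeExponent_mk, edgeExponent_mk, ← add_assoc, add_tsub_cancel_right]
      rw [h2]
      by_contra h3
      exact (hf.adj (right_ne_zero_of_mul h3)).ne rfl
    · rw [mul_zero]
  · simp

/-- Three terms can contribute to `x_t x_a x_b e_{S \ t}` in `∂f = 0`, one for each variable; if one
is nonzero, so is another. -/
theorem IsEdgeChain.exchange (hf : IsEdgeChain G f) (hd : koszulD k V _ f = 0) {S : Finset V}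
    {a b t : V} (h : coeff (edgeExponent s(a, b)) (f S PUnit.unit) ≠ 0) (ht : t ∈ S) :
    coeff (edgeExponent s(b, t)) (f (insert a (S.erase t)) PUnit.unit) ≠ 0 ∨
      coeff (edgeExponent s(a, t)) (f (insert b (S.erase t)) PUnit.unit) ≠ 0 := by
  by_contra! hcon
  have hab := hf.adj h
  have ha : a ≠ t := fun e => hf.notMem hd h (e ▸ ht)
  have hb : b ≠ t := fun e => by
    rw [Sym2.eq_swap] at h
    exact hf.notMem hd h (e ▸ ht)
  have h1 := coeff_koszulD f (S.erase t) PUnit.unit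
    (Finsupp.single t 1 + edgeExponent s(a, b))
  rw [hd, Finset.sum_eq_single t, Finset.insert_erase ht, if_pos (by simp),
    add_tsub_cancel_left] at h1
  · exact mul_ne_zero (koszulSign_ne_zero _ _) h h1.symm
  · intro c _ hct
    split_ifs with hc
    · have hcb : c = a ∨ c = b := by
        by_contra! hcb
        simp [edgeExponent_mk, hct.symm, hcb.1.symm, hcb.2.symm] at hc
      rcases hcb with rfl | rfl
      · have h2 : Finsupp.single t 1 + edgeExponent s(c, b) - Finsupp.single c 1 =
            edgeExponent s(b, t) := by
          rw [edgeExponent_mk, edgeExponent_mk, add_left_comm, add_tsub_cancel_left, add_comm]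
        rw [h2, hcon.1, mul_zero]
      · have h2 : Finsupp.single t 1 + edgeExponent s(a, c) - Finsupp.single c 1 =
            edgeExponent s(a, t) := by
          rw [edgeExponent_mk, edgeExponent_mk, ← add_assoc, add_tsub_cancel_right, add_comm]
        rw [h2, hcon.2, mul_zero]
    · rw [mul_zero]
  · simp

/-- In a forest, a nonzero coefficient of a Koszul cycle determines a star on which the cycle does
not vanish. -/
theorem IsEdgeChain.exists_star (hG : G.IsAcyclic) (hf : IsEdgeChain G f)
    (hd : koszulD k V _ f = 0) {S : Finset V} {m : V →₀ ℕ}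
    (h : coeff m (f S PUnit.unit) ≠ 0) :
    ∃ (v : V) (L : Finset V), (∀ u ∈ L, G.Adj v u) ∧ L.card = S.card + 1 ∧
      ∀ u ∈ L, coeff (edgeExponent s(v, u)) (f (L.erase u) PUnit.unit) ≠ 0 := by
  have key : ∀ a b : V, coeff (edgeExponent s(a, b)) (f S PUnit.unit) ≠ 0 →
      (∀ t ∈ S, G.Adj a t) → ∃ (v : V) (L : Finset V), (∀ u ∈ L, G.Adj v u) ∧
        L.card = S.card + 1 ∧
        ∀ u ∈ L, coeff (edgeExponent s(v, u)) (f (L.erase u) PUnit.unit) ≠ 0 := by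
    intro a b h hS
    have hab := hf.adj h
    have hb : b ∉ S := by
      rw [Sym2.eq_swap] at h
      exact hf.notMem hd h
    refine ⟨a, insert b S, ?_, Finset.card_insert_of_notMem hb, ?_⟩
    · intro u hu
      rcases Finset.mem_insert.1 hu with rfl | hu
      exacts [hab, hS u hu]
    · intro u hu
      rcases Finset.mem_insert.1 hu with rfl | hu
      · rwa [Finset.erase_insert hb]
      · rw [Finset.erase_insert_of_ne (fun e : b = u => hb (e ▸ hu))]
        rcases hf.exchange hd h hu with h1 | h1
        · exact absurd (hS u hu) (not_adj_of_isAcyclic hG hab (hf.adj h1))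
        · exact h1
  obtain ⟨e, he, rfl⟩ := hf S m h
  induction e using Sym2.ind with | _ a b =>
  have hab : G.Adj a b := he
  by_cases ha : ∀ t ∈ S, G.Adj a t
  · exact key a b h ha
  by_cases hb : ∀ t ∈ S, G.Adj b t
  · exact key b a (by rwa [Sym2.eq_swap]) hb
  push Not at ha hb
  obtain ⟨t, ht, hat⟩ := ha
  obtain ⟨s, hs, hbs⟩ := hb
  -- If neither end of the edge is adjacent to all of `S`, then `b ~ t` and `a ~ s`. A second
  -- exchange, from the edge `bt`, yields `t ~ s` and the forbidden 4-cycle `a b t s`.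
  have h1 := (hf.exchange hd h ht).resolve_right fun h' => hat (hf.adj h')
  have hbt := hf.adj h1
  have has : G.Adj a s :=
    ((hf.exchange hd h hs).imp_left fun h' => hbs (hf.adj h')).elim False.elim hf.adj
  have hst : s ≠ t := fun e => hat (e ▸ has)
  rcases hf.exchange hd h1 (Finset.mem_insert_of_mem (Finset.mem_erase.2 ⟨hst, hs⟩)) with h2 | h2
  · have hts := hf.adj h2
    have hbs' : b ≠ s := by
      rintro rfl
      rw [Sym2.eq_swap] at h
      exact hf.notMem hd h hs
    have hta : a = t := eq_of_isAcyclic hG hbs' hab.symm has hbt hts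
    exact absurd (hta ▸ ht) (hf.notMem hd h)
  · exact absurd (hf.adj h2) hbs

end Cycles

/-! ### Star cycles and the dimension count -/

/-- The Koszul boundary `x_v ∂(e_L)`. -/
def starCycle (k : Type v) [Field k] (v : V) (L : Finset V) :
    Finset V → PUnit.{w + 1} →₀ MvPolynomial V k :=
  koszulD k V _ (Pi.single L (Finsupp.single PUnit.unit (X v)))

theorem coeff_starCycle (v : V) (L S : Finset V) (m : V →₀ ℕ) :
    coeff m (starCycle.{u, v, w} k v L S PUnit.unit) = ∑ t ∈ Sᶜ,
      if insert t S = L ∧ m = edgeExponent s(v, t) then (koszulSign t S : k) else 0 := by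
  rw [starCycle, coeff_koszulD]
  refine Finset.sum_congr rfl fun t _ => ?_
  by_cases hL : insert t S = L
  · subst hL
    rw [Pi.single_eq_same, Finsupp.single_eq_same, coeff_X]
    by_cases ht : t ∈ m.support
    · have hle : Finsupp.single t 1 ≤ m :=
        Finsupp.single_le_iff.2 (Nat.one_le_iff_ne_zero.2 (Finsupp.mem_support_iff.1 ht))
      have hiff : Finsupp.single v 1 = m - Finsupp.single t 1 ↔ m = edgeExponent s(v, t) := by
        rw [edgeExponent_mk, eq_comm, tsub_eq_iff_eq_add_of_le hle]
      rw [if_pos ht]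
      simp only [hiff, true_and, mul_ite, mul_one, mul_zero]
    · rw [if_neg ht, mul_zero, if_neg]
      rintro ⟨-, rfl⟩
      exact ht (by simp [edgeExponent_mk])
  · rw [Pi.single_eq_of_ne hL]
    simp [hL]

theorem coeff_starCycle_self {v t : V} {L : Finset V} (ht : t ∈ L) (hmin : ∀ u ∈ L, t ≤ u) :
    coeff (edgeExponent s(v, t)) (starCycle.{u, v, w} k v L (L.erase t) PUnit.unit) = 1 := by
  rw [coeff_starCycle, Finset.sum_eq_single t, if_pos ⟨Finset.insert_erase ht, rfl⟩,
    koszulSign_eq_one fun u hu => hmin u (Finset.mem_of_mem_erase hu), Int.cast_one]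
  · intro s _ hst
    refine if_neg fun h => hst ?_
    exact (Sym2.congr_right.1 (edgeExponent_injective h.2)).symm
  · simp

theorem coeff_starCycle_of_ne (hG : G.IsAcyclic) {v v' t : V} {L L' : Finset V}
    (hL : ∀ u ∈ L, G.Adj v u) (hL' : ∀ u ∈ L', G.Adj v' u) (ht : t ∈ L') (hcard : 1 < L'.card)
    (hne : v ≠ v' ∨ L ≠ L') :
    coeff (edgeExponent s(v', t)) (starCycle.{u, v, w} k v L (L'.erase t) PUnit.unit) = 0 := by
  rw [coeff_starCycle]
  refine Finset.sum_eq_zero fun s _ => if_neg ?_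
  rintro ⟨h1, h2⟩
  rcases Sym2.eq_iff.1 (edgeExponent_injective h2) with ⟨rfl, rfl⟩ | ⟨rfl, rfl⟩
  · rw [Finset.insert_erase ht] at h1
    exact hne.elim (fun h => h rfl) fun h => h h1.symm
  -- With the roles of centre and leaf swapped, a second leaf `r` gives a triangle. This fails for
  -- single edges, which are stars about either end.
  · obtain ⟨r, hr⟩ : (L'.erase t).Nonempty := by
      rw [← Finset.card_pos, Finset.card_erase_of_mem ht]
      omega
    exact not_adj_of_isAcyclic hG (hL' t ht)
      (hL r (h1 ▸ Finset.mem_insert_of_mem hr)) (hL' r (Finset.mem_of_mem_erase hr))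

/-- The cycle condition is `∂∂ = 0`. It is a boundary over `R`, but `x_v` is not in the edge ideal.
-/
theorem starCycle_mem {v : V} {L : Finset V} {i : ℕ} (hL : ∀ u ∈ L, G.Adj v u)
    (hcard : L.card = i + 1) :
    starCycle k v L ∈ koszulPiece (imPiece (F.deg 0) (augVec F) 2) i ⊓
      LinearMap.ker (koszulD k V _) := by
  have hmem : ∀ S m, coeff m (starCycle.{u, v, max u v} k v L S PUnit.unit) ≠ 0 →
      ∃ t, t ∉ S ∧ insert t S = L ∧ m = edgeExponent s(v, t) := by
    intro S m h
    rw [coeff_starCycle] at h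
    obtain ⟨t, ht, h'⟩ := Finset.exists_ne_zero_of_sum_ne_zero h
    have h2 := (ite_ne_right_iff.1 h').1
    exact ⟨t, Finset.mem_compl.1 ht, h2⟩
  refine ⟨mem_koszulPiece.2 ⟨fun S => (mem_imPiece_augVec_two F).2 fun m h => ?_,
    fun S hS => vec_ext fun _ m => ?_⟩, koszulD_koszulD _⟩
  · obtain ⟨t, -, rfl, rfl⟩ := hmem S m h
    exact ⟨_, hL t (Finset.mem_insert_self t S), rfl⟩
  · by_contra h
    obtain ⟨t, ht, rfl, -⟩ := hmem S m h
    rw [Finset.card_insert_of_notMem ht] at hcard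
    omega

/-- The linear strand of the Koszul homology consists of the cycles. -/
theorem rank_koszulHomology_linear (i : ℕ) :
    Module.rank k (koszulHomology (imPiece (F.deg 0) (augVec F)) i 1) =
      Module.rank k ↥(koszulPiece (imPiece (F.deg 0) (augVec F) 2) i ⊓
        LinearMap.ker (koszulD k V _)) := by
  have h : (koszulPiece (imPiece (F.deg 0) (augVec F) 1) (i + 1)).map (koszulD k V _) = ⊥ := by
    rw [eq_bot_iff, Submodule.map_le_iff_le_comap]
    intro f hf
    rw [imPiece_augVec_one] at hf
    have : f = 0 := funext fun S => (Submodule.mem_bot k).1 ((mem_koszulPiece.1 hf).1 S)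
    rw [this]
    exact Submodule.zero_mem _
  refine (Submodule.equivMapOfInjective _ ?_ _).rank_eq.symm
  rw [← LinearMap.ker_eq_bot, Submodule.ker_mkQ]
  exact h

theorem rank_linear_cycles_succ [DecidableRel G.Adj] (hG : G.IsAcyclic) {i : ℕ} (hi : 1 ≤ i) :
    Module.rank k ↥(koszulPiece (imPiece (F.deg 0) (augVec F) 2) i ⊓
      LinearMap.ker (koszulD k V _)) = ((∑ v : V, (G.degree v).choose (i + 1) : ℕ) : Cardinal) := by
  let J : Type u := Σ v : V, {L // L ∈ (G.neighborFinset v).powersetCard (i + 1)}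
  have hJ : Fintype.card J = ∑ v : V, (G.degree v).choose (i + 1) := by
    simp only [J, Fintype.card_sigma, Fintype.card_coe, Finset.card_powersetCard,
      SimpleGraph.card_neighborFinset_eq_degree]
  have hadj : ∀ j : J, ∀ u ∈ j.2.1, G.Adj j.1 u := fun j u hu =>
    (G.mem_neighborFinset _ _).1 ((Finset.mem_powersetCard.1 j.2.2).1 hu)
  have hcard : ∀ j : J, j.2.1.card = i + 1 := fun j => (Finset.mem_powersetCard.1 j.2.2).2
  have hmin : ∀ j : J, ∃ t ∈ j.2.1, ∀ u ∈ j.2.1, t ≤ u := fun j => by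
    have hne : j.2.1.Nonempty := by rw [← Finset.card_pos, hcard]; omega
    exact ⟨_, Finset.min'_mem _ hne, fun u hu => Finset.min'_le _ u hu⟩
  choose t ht htmin using hmin
  -- One coefficient per star, at its least leaf, where the sign in the star cycle is `1`; the
  -- matrix on star cycles is the identity.
  let ev : (Finset V → PUnit.{max u v + 1} →₀ MvPolynomial V k) →ₗ[k] (J → k) :=
    { toFun := fun f j => coeff (edgeExponent s(j.1, t j)) (f (j.2.1.erase (t j)) PUnit.unit)
      map_add' := fun f g => funext fun j => by simp
      map_smul' := fun c f => funext fun j => by simp }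
  rw [← hJ]
  refine rank_eq_card ev ?_ ?_
  · rintro f ⟨hf, hd⟩ h0
    refine funext fun S => vec_ext fun _ m => ?_
    by_contra h
    have hS : S.card = i := by
      by_contra hS
      exact h (by rw [(mem_koszulPiece.1 hf).2 S hS]; rfl)
    obtain ⟨v, L, h1, h2, h3⟩ := (isEdgeChain_of_mem F hf).exists_star hG hd h
    let j : J := ⟨v, L, Finset.mem_powersetCard.2
      ⟨fun u hu => (G.mem_neighborFinset _ _).2 (h1 u hu), by rw [h2, hS]⟩⟩
    exact h3 (t j) (ht j) (congrFun h0 j)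
  · intro x
    refine ⟨∑ j, x j • starCycle k j.1 j.2.1, Submodule.sum_mem _ fun j _ =>
      Submodule.smul_mem _ _ (starCycle_mem F (hadj j) (hcard j)), ?_⟩
    rw [map_sum]
    funext j'
    rw [Finset.sum_apply, Finset.sum_eq_single j']
    · rw [map_smul, Pi.smul_apply]
      exact (congrArg (x j' • ·) (coeff_starCycle_self (ht j') (htmin j'))).trans (mul_one _)
    · intro j _ hj
      rw [map_smul, Pi.smul_apply]
      refine (congrArg (x j • ·) (coeff_starCycle_of_ne hG (hadj j) (hadj j') (ht j')
        (by rw [hcard]; omega) ?_)).trans (mul_zero _)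
      by_contra! h
      obtain ⟨v, L, hL⟩ := j
      obtain ⟨v', L', hL'⟩ := j'
      obtain ⟨rfl, rfl⟩ := h
      exact hj rfl
    · simp

theorem rank_linear_cycles_zero [Fintype G.edgeSet] :
    Module.rank k ↥(koszulPiece (imPiece (F.deg 0) (augVec F) 2) 0 ⊓
      LinearMap.ker (koszulD k V _)) = (G.edgeFinset.card : Cardinal) := by
  let ev : (Finset V → PUnit.{max u v + 1} →₀ MvPolynomial V k) →ₗ[k] (G.edgeFinset → k) :=
    { toFun := fun f e => coeff (edgeExponent e.1) (f ∅ PUnit.unit)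
      map_add' := fun f g => funext fun j => by simp
      map_smul' := fun c f => funext fun j => by simp }
  rw [← Fintype.card_coe]
  refine rank_eq_card ev ?_ ?_
  · rintro f ⟨hf, -⟩ h0
    refine koszulPiece_zero_ext hf (Submodule.zero_mem _) (vec_ext fun _ m => ?_)
    by_contra h
    obtain ⟨e, he, rfl⟩ := isEdgeChain_of_mem F hf ∅ m h
    exact h (congrFun h0 ⟨e, SimpleGraph.mem_edgeFinset.2 he⟩)
  · intro x
    let p : MvPolynomial V k := ∑ e, monomial (edgeExponent e.1) (x e)
    have hp : ∀ m, coeff m p = ∑ e, if edgeExponent e.1 = m then x e else 0 := by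
      intro m
      simp only [p, coeff_sum, coeff_monomial]
    refine ⟨koszulSingle k V _ (Finsupp.single PUnit.unit p), ⟨koszulSingle_mem
      ((mem_imPiece_augVec_two F).2 fun m hm => ?_), koszulD_koszulSingle _⟩, funext fun e => ?_⟩
    · rw [Finsupp.single_eq_same, hp] at hm
      obtain ⟨e, -, he⟩ := Finset.exists_ne_zero_of_sum_ne_zero hm
      exact ⟨e.1, SimpleGraph.mem_edgeFinset.1 e.2, (ite_ne_right_iff.1 he).1.symm⟩
    · change coeff (edgeExponent e.1) (koszulSingle k V _ _ ∅ PUnit.unit) = x e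
      rw [koszulSingle_empty, Finsupp.single_eq_same, hp, Finset.sum_eq_single e, if_pos rfl]
      · exact fun e' _ h => if_neg fun h' => h (Subtype.ext (edgeExponent_injective h'))
      · simp

end Graph
end GradedBetti

end

theorem corollary2p6 {k : Type*} [Field k] {V : Type*} [Fintype V] [DecidableEq V]
    (G : SimpleGraph V) [DecidableRel G.Adj] (hG : G.IsAcyclic) :
    GradedBetti.gradedBetti (GradedBetti.edgeIdeal k G) 0 2 = (G.edgeFinset.card : Cardinal) ∧
      ∀ i : ℕ, 1 ≤ i →
        GradedBetti.gradedBetti (GradedBetti.edgeIdeal k G) i (i + 2) =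
          ((∑ v : V, (G.degree v).choose (i + 1) : ℕ) : Cardinal) := by
  -- Any order serves: it only fixes signs and choices of minima.
  let : LinearOrder V := LinearOrder.lift' (Fintype.equivFin V) (Fintype.equivFin V).injective
  have key : ∀ i : ℕ, GradedBetti.gradedBetti (GradedBetti.edgeIdeal k G) i (i + 2) = _ := fun i =>
    (congrArg (fun j => GradedBetti.gradedBetti (GradedBetti.edgeIdeal k G) i j)
      (show i + 2 = 1 + i + 1 by omega)).trans
      ((GradedBetti.rank_tor_eq_rank_koszulHomology (GradedBetti.resolution _) i 1).trans
        (GradedBetti.rank_koszulHomology_linear (GradedBetti.resolution _) i))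
  exact ⟨(key 0).trans (GradedBetti.rank_linear_cycles_zero _),
    fun i hi => (key i).trans (GradedBetti.rank_linear_cycles_succ _ hG hi)⟩
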